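/- All graphs are finite and simple. **Ear decompositions.** An *ear* is a path on at least $3$ vertices or a star on $4$ vertices; it is *short* if it has at most $5$ vertices. For an ear $L$, let $I(L)$ be the set of its vertices of degree at least $2$ in $L$; the remaining vertices are its leaves. A $k$-ear is an ear that is a path with $|I(L)|=k$. An *ear decomposition* $(H_0,H_i,L_i)^n$ of a graph $H$ consists of a cycle $H_0\subseteq H$, short ears $L_1,\dots,L_n$ and subgraphs $H_i=H_{i-1}\cup L_i$ $(1\le i\le n)$ with $H_n=H$, such that $L_i$ meets $H_{i-1}$ exactly in the leaves of $L_i$. A *trigraph* is a cubic graph that has an ear decomposition. For a 3-ear $L_i$, the *descendant* of $I(L_i)$ is the union of those connected components of $H-V(H_i)$ that are joined to $I(L_i)$ by an edge. The ear decomposition is *robust* if, for each 3-ear $L_i$, the descendant of $I(L_i)$ has at most two connected components and, if it has two, one of them is an isolated vertex adjacent to two vertices of $H_0$. **Mixed graphs.** A *mixed graph* $(V,E,A,R)$ consists of a vertex set $V$, a set $E$ of undirected edges, a finite set $A$ of arcs (parallel arcs and directed loops are allowed) and a set $R$ of unordered pairs of distinct arcs (*forbidden pairs*), such that every vertex has degree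 $d\in\{1,2,3\}$ in $(V,E)$ and is the tail of exactly $3-d$ arcs and the head of exactly $3-d$ arcs. A set $U\subseteq V$ is a *cut-obstacle* in $(V,E,A,R)$ if twice the number of edges with exactly one end vertex in $U$ is strictly less than the number of arcs with exactly one end vertex in $U$. **Correct reductions.** Let $U\subseteq V$, let $A(U)$ be the set of arcs incident with $U$ and let $\tilde A$ be the set of arcs obtained by replacing each edge of $E$ incident with $U$ by two oppositely directed arcs. A *correct reduction* of $U$ on $(V,E,A,R)$ is given by a partition $\mathcal S$ of $A(U)\cup\tilde A$ into correct directed paths and correct directed cycles, and outputs a mixed graph $(V',E',A',R')$. Here a directed path or cycle (a directed loop counts as a cycle) is *correct* if no two of its arcs form a forbidden pair and it is not a $2$-cycle composed only of arcs of $\tilde A$; moreover a correct path must have both its end vertices, which are allowed to coincide, in $V\setminus U$. The output is: $V'=V\setminus U$; $E'$ is the set of edges of $E$ not incident with $U$; $A'$ consists of the arcs of $A$ not incident with $U$ and, for each path $P\in\mathcal S$, a new arc $\vec e_P$ from the initial to the terminal vertex of $P$; and $R'$ consists of the pairs of $R$ between arcs not incident with $U$, the pairs $\{\vec e_P,\vec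 e_{P'}\}$ with $P\ne P'$ such that $P,P'$ have a common vertex or there are $\vec e\in P$, $\vec g\in P'$ with $\{\vec e,\vec g\}\in R$, and the pairs $\{\vec e_P,\vec g\}$ with $\vec g\in A$ not incident with $U$ such that $\{\vec e,\vec g\}\in R$ for some arc $\vec e$ of $P$. For $1\le j\le n$, a *consecutive correct reduction* of $I(L_n),I(L_{n-1}),\dots,I(L_j)$ is a sequence of mixed graphs $M_n,M_{n-1},\dots,M_{j-1}$ with $M_n=(V(H),E(H),\emptyset,\emptyset)$ such that, for $i=n,\dots,j$, $M_{i-1}$ is the output of a correct reduction of $I(L_i)$ on $M_i$. **Superb.** An ear decomposition $(H_0,H_i,L_i)^n$ of a trigraph $H$ is *superb* if for some $j\in\{1,\dots,n\}$ there is a consecutive correct reduction $M_n,\dots,M_{j-1}$ of $I(L_n),\dots,I(L_j)$ such that (i) $j=1$, or $I(L_{j-1})$ cannot be correctly reduced on $M_{j-1}$; and (ii) for every 3-ear $L_i$ with $i\ge 1$ and $j-1\le i\le n$, the set $I(L_i)$ is not a cut-obstacle in $M_i$, the mixed graph obtained after reducing $I(L_n),\dots,I(L_{i+1})$. **Observation.**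 Every robust ear decomposition of a planar trigraph $H$ is superb. -/

import Mathlib

universe u

section EarDecompositions

variable {V : Type u} {H : SimpleGraph V}

/-- `I(L)`: the set of vertices of degree at least two in the subgraph `L`. -/
def internalVerts (L : H.Subgraph) : Set V :=
  {v | v ∈ L.verts ∧ 2 ≤ (L.neighborSet v).ncard}

/-- The subgraph `L` is a path. -/
def IsPathSubgraph (L : H.Subgraph) : Prop :=
  ∃ (a b : V) (p : H.Walk a b), p.IsPath ∧ L = p.toSubgraph

/-- The subgraph `L` is a cycle. -/
def IsCycleSubgraph (L : H.Subgraph) : Prop :=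
  ∃ (a : V) (p : H.Walk a a), p.IsCycle ∧ L = p.toSubgraph

/-- The subgraph `L` is a star on four vertices. -/
def IsStarSubgraph (L : H.Subgraph) : Prop :=
  ∃ c x y z : V, [c, x, y, z].Nodup ∧ L.verts = {c, x, y, z} ∧
    L.edgeSet = {s(c, x), s(c, y), s(c, z)}

/-- An ear: a path on at least three vertices, or a star on four vertices. -/
def IsEar (L : H.Subgraph) : Prop :=
  (IsPathSubgraph L ∧ 3 ≤ L.verts.ncard) ∨ IsStarSubgraph L

/-- A short ear: an ear on at most five vertices. -/
def IsShortEar (L : H.Subgraph) : Prop :=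
  IsEar L ∧ L.verts.ncard ≤ 5

/-- A `k`-ear: an ear that is a path and has exactly `k` internal vertices. -/
def IsKEar (k : ℕ) (L : H.Subgraph) : Prop :=
  IsEar L ∧ IsPathSubgraph L ∧ (internalVerts L).ncard = k

variable (H) in
/-- A short-ear decomposition `(H₀, Hᵢ, Lᵢ)ⁿ` of `H`. Only the values `part i` for `0 ≤ i ≤ n`
and `ear i` for `1 ≤ i ≤ n` are meaningful: `part 0` is the initial cycle, and `part (i + 1)`
arises from `part i` by adding the ear `ear (i + 1)`, which meets `part i` exactly in its leaves. -/
structure EarDecomposition where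
  /-- the number of ears -/
  n : ℕ
  /-- the intermediate graphs `Hᵢ` -/
  part : ℕ → H.Subgraph
  /-- the ears `Lᵢ` -/
  ear : ℕ → H.Subgraph
  part_zero : IsCycleSubgraph (part 0)
  isShortEar : ∀ i, 1 ≤ i → i ≤ n → IsShortEar (ear i)
  attach : ∀ i, i < n →
    (ear (i + 1)).verts ∩ (part i).verts = (ear (i + 1)).verts \ internalVerts (ear (i + 1))
  part_succ : ∀ i, i < n → part (i + 1) = part i ⊔ ear (i + 1)
  part_last : part n = ⊤

/-- A trigraph: a cubic graph that has a short-ear decomposition. -/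
def IsTrigraph (H : SimpleGraph V) [H.LocallyFinite] : Prop :=
  H.IsRegularOfDegree 3 ∧ Nonempty (EarDecomposition H)

namespace EarDecomposition

/-- The connected components of the descendant of `I(Lᵢ)`: the components of `H - V(Hᵢ)` that are
joined to `I(Lᵢ)` by an edge. The descendant is their union. -/
def descendantComponents (D : EarDecomposition H) (i : ℕ) :
    Set (H.induce ((D.part i).verts)ᶜ).ConnectedComponent :=
  {C | ∃ x ∈ C.supp, ∃ v ∈ internalVerts (D.ear i), H.Adj v x}

/-- Robustness: for each 3-ear the descendant has at most two components, and if it has two, then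
one of them is an isolated vertex adjacent to two vertices of the initial cycle. -/
def IsRobust (D : EarDecomposition H) : Prop :=
  ∀ i, 1 ≤ i → i ≤ D.n → IsKEar 3 (D.ear i) →
    (D.descendantComponents i).ncard ≤ 2 ∧
    ((D.descendantComponents i).ncard = 2 →
      ∃ C ∈ D.descendantComponents i, ∃ x, C.supp = {x} ∧
        ∃ a ∈ (D.part 0).verts, ∃ b ∈ (D.part 0).verts,
          a ≠ b ∧ H.Adj (x : V) a ∧ H.Adj (x : V) b)

end EarDecomposition

end EarDecompositions

section Planarity

variable {V : Type u}

/-- A rotation system (the combinatorial description of a cellular embedding of a graph in an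
oriented surface): a cyclic ordering, at each vertex, of the darts (oriented edges) leaving it. -/
structure RotationSystem (H : SimpleGraph V) where
  /-- the next dart in the rotation around the initial vertex of a dart -/
  next : Equiv.Perm H.Dart
  next_fst : ∀ d, (next d).fst = d.fst
  sameCycle : ∀ d d' : H.Dart, d.fst = d'.fst → next.SameCycle d d'

/-- Face tracing: traverse a dart, then turn into the next dart at its terminal vertex.
The cycles of this permutation are the facial walks. -/
def RotationSystem.facePerm {H : SimpleGraph V} (ρ : RotationSystem H) : Equiv.Perm H.Dart :=
  (SimpleGraph.Dart.symm_involutive (G := H)).toPerm.trans ρ.next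

/-- The number of faces: one for each facial walk, and one for each isolated vertex (which carries
no dart), where each connected component is embedded in a surface of its own. -/
noncomputable def RotationSystem.numFaces {H : SimpleGraph V} (ρ : RotationSystem H) : ℕ :=
  Nat.card (Quotient (Equiv.Perm.SameCycle.setoid ρ.facePerm)) + {v : V | ∀ w, ¬ H.Adj v w}.ncard

/-- Planarity of a finite graph: there is an embedding, given by a rotation system, in which each
component is embedded in the sphere, that is, the Euler characteristic `|V| - |E| + |F|` is twice
the number of components (its largest possible value; for connected `H` this is Euler's formula
`|V| - |E| + |F| = 2`). -/
def IsPlanarGraph (H : SimpleGraph V) : Prop :=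
  ∃ ρ : RotationSystem H,
    Nat.card V + ρ.numFaces = H.edgeSet.ncard + 2 * Nat.card H.ConnectedComponent

end Planarity

section MixedGraphs

/-- A mixed graph `(V, E, A, R)` whose vertex set is a subset of the ambient type `V`. Arcs form a
finite type, so that parallel arcs and directed loops are possible. `forbidden` is the set `R` of
(unordered) pairs of distinct arcs. The degree conditions say that a vertex of degree `d` in
`(V, E)`, with `1 ≤ d ≤ 3`, is the tail of exactly `3 - d` arcs and the head of exactly `3 - d`
arcs. -/
structure MixedGraph (V : Type u) where
  verts : Set V
  edges : Set (Sym2 V)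
  Arc : Type u
  tail : Arc → V
  head : Arc → V
  forbidden : Arc → Arc → Prop
  finite_arc : Finite Arc
  forbidden_symm : ∀ a b, forbidden a b → forbidden b a
  forbidden_irrefl : ∀ a, ¬ forbidden a a
  edges_not_isDiag : ∀ e ∈ edges, ¬ e.IsDiag
  edges_subset : ∀ e ∈ edges, ∀ v ∈ e, v ∈ verts
  tail_mem : ∀ a, tail a ∈ verts
  head_mem : ∀ a, head a ∈ verts
  one_le_degree : ∀ v ∈ verts, 1 ≤ {e ∈ edges | v ∈ e}.ncard
  degree_add_out : ∀ v ∈ verts, {e ∈ edges | v ∈ e}.ncard + {a | tail a = v}.ncard = 3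
  degree_add_in : ∀ v ∈ verts, {e ∈ edges | v ∈ e}.ncard + {a | head a = v}.ncard = 3

namespace MixedGraph

variable {V : Type u}

/-- `U` is a cut-obstacle in `M`: among the edges and arcs with exactly one end vertex in `U`, twice
the number of edges is strictly less than the number of arcs. -/
def IsCutObstacle (M : MixedGraph V) (U : Set V) : Prop :=
  2 * {e ∈ M.edges | (∃ v ∈ e, v ∈ U) ∧ ∃ v ∈ e, v ∉ U}.ncard <
    {a : M.Arc | (M.tail a ∈ U ∧ M.head a ∉ U) ∨ (M.tail a ∉ U ∧ M.head a ∈ U)}.ncard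

/-- The set `A(U) ∪ Ã`: the arcs of `M` incident with `U`, together with the two orientations
`(x, y)`, `(y, x)` of each edge `{x, y}` of `M` incident with `U`. -/
def RedArc (M : MixedGraph V) (U : Set V) : Type u :=
  {a : M.Arc // M.tail a ∈ U ∨ M.head a ∈ U} ⊕
    {d : V × V // s(d.1, d.2) ∈ M.edges ∧ (d.1 ∈ U ∨ d.2 ∈ U)}

namespace RedArc

variable {M : MixedGraph V} {U : Set V}

/-- The tail of an element of `A(U) ∪ Ã`. -/
def tail (e : M.RedArc U) : V := Sum.elim (fun a => M.tail a.1) (fun d => d.1.1) e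

/-- The head of an element of `A(U) ∪ Ã`. -/
def head (e : M.RedArc U) : V := Sum.elim (fun a => M.head a.1) (fun d => d.1.2) e

/-- `e` is the arc `a` of `M`. -/
def IsArc (e : M.RedArc U) (a : M.Arc) : Prop := ∃ h, e = Sum.inl ⟨a, h⟩

/-- `e` belongs to `Ã`. -/
def FromEdge (e : M.RedArc U) : Prop := ∃ d, e = Sum.inr d

/-- The vertex `v` lies on `P`. -/
def OnVertex (P : List (M.RedArc U)) (v : V) : Prop := ∃ e ∈ P, v = e.tail ∨ v = e.head

/-- The arc `a` of `M` lies on `P`. -/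
def OnArc (P : List (M.RedArc U)) (a : M.Arc) : Prop := ∃ e ∈ P, e.IsArc a

/-- `P` is a nonempty sequence of consecutive arcs without repeated vertices, except that the
terminal vertex may coincide with the initial vertex. -/
structure IsDipath (P : List (M.RedArc U)) : Prop where
  ne_nil : P ≠ []
  chain : P.IsChain (fun e f => e.head = f.tail)
  tails_nodup : (P.map tail).Nodup
  heads_nodup : (P.map head).Nodup

/-- The terminal vertex of `P` is its initial vertex. -/
def IsClosed (P : List (M.RedArc U)) : Prop :=
  P.getLast?.map head = P.head?.map tail

/-- No two arcs of `P` form a forbidden pair, and `P` is not a 2-cycle consisting of elements of `Ã`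
only. -/
def IsCorrect (P : List (M.RedArc U)) : Prop :=
  (∀ a b, OnArc P a → OnArc P b → ¬ M.forbidden a b) ∧
    ¬ (P.length = 2 ∧ IsClosed P ∧ ∀ e ∈ P, e.FromEdge)

/-- A correct directed path: its two end vertices (which may coincide, so that its replacement is a
directed loop) lie outside `U`. -/
def IsCorrectPath (P : List (M.RedArc U)) : Prop :=
  IsDipath P ∧ IsCorrect P ∧ (∀ e ∈ P.head?, e.tail ∉ U) ∧ ∀ e ∈ P.getLast?, e.head ∉ U

/-- A correct directed cycle, listed from some starting vertex. A directed loop is a cycle. -/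
def IsCorrectCycle (P : List (M.RedArc U)) : Prop :=
  IsDipath P ∧ IsClosed P ∧ IsCorrect P

end RedArc

open RedArc in
/-- A correct reduction of `U` on the mixed graph `M` with output the mixed graph `M'`.
The list of correct paths and correct cycles partitions `A(U) ∪ Ã`. The arcs of `M'` are the arcs of
`M` not incident with `U`, together with one new arc for each of the correct paths; `arcEquiv`
makes this identification. -/
structure CorrectReduction (M : MixedGraph V) (U : Set V) (M' : MixedGraph V) where
  paths : Set (List (M.RedArc U))
  cycles : Set (List (M.RedArc U))
  subset_verts : U ⊆ M.verts
  isCorrectPath : ∀ P ∈ paths, IsCorrectPath P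
  isCorrectCycle : ∀ C ∈ cycles, IsCorrectCycle C
  partition : ∀ e : M.RedArc U, ∃! P, P ∈ paths ∪ cycles ∧ e ∈ P
  verts_eq : M'.verts = M.verts \ U
  edges_eq : M'.edges = {e ∈ M.edges | ∀ v ∈ e, v ∉ U}
  arcEquiv : {a : M.Arc // M.tail a ∉ U ∧ M.head a ∉ U} ⊕ paths ≃ M'.Arc
  tail_old : ∀ a, M'.tail (arcEquiv (Sum.inl a)) = M.tail a.1
  head_old : ∀ a, M'.head (arcEquiv (Sum.inl a)) = M.head a.1
  tail_new : ∀ P : paths, some (M'.tail (arcEquiv (Sum.inr P))) = P.1.head?.map RedArc.tail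
  head_new : ∀ P : paths, some (M'.head (arcEquiv (Sum.inr P))) = P.1.getLast?.map RedArc.head
  forbidden_old_old : ∀ a b,
    M'.forbidden (arcEquiv (Sum.inl a)) (arcEquiv (Sum.inl b)) ↔ M.forbidden a.1 b.1
  forbidden_new_old : ∀ (P : paths) b,
    M'.forbidden (arcEquiv (Sum.inr P)) (arcEquiv (Sum.inl b)) ↔
      ∃ a, OnArc P.1 a ∧ M.forbidden a b.1
  forbidden_new_new : ∀ P Q : paths,
    M'.forbidden (arcEquiv (Sum.inr P)) (arcEquiv (Sum.inr Q)) ↔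
      P ≠ Q ∧ ((∃ v, OnVertex P.1 v ∧ OnVertex Q.1 v) ∨
        ∃ a b, OnArc P.1 a ∧ OnArc Q.1 b ∧ M.forbidden a b)

/-- `U` can be correctly reduced on `M`. -/
def CanReduce (M : MixedGraph V) (U : Set V) : Prop :=
  ∃ M' : MixedGraph V, Nonempty (CorrectReduction M U M')

/-- `M` is the mixed graph `(V(H), E(H), ∅, ∅)`. -/
def IsInitial (M : MixedGraph V) (H : SimpleGraph V) : Prop :=
  M.verts = Set.univ ∧ M.edges = H.edgeSet ∧ IsEmpty M.Arc

/-- `M k, M (k - 1), …, M (j - 1)` is a consecutive correct reduction of the vertex sets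
`U k, U (k - 1), …, U j` of `H`, where `1 ≤ j`. -/
def IsCcr (H : SimpleGraph V) (U : ℕ → Set V) (k j : ℕ) (M : ℕ → MixedGraph V) : Prop :=
  (M k).IsInitial H ∧
    ∀ i, j ≤ i + 1 → i + 1 ≤ k → Nonempty (CorrectReduction (M (i + 1)) (U (i + 1)) (M i))

end MixedGraph

/-- An ear decomposition is superb if for some `1 ≤ j ≤ n` there is a consecutive correct reduction
of `I(Lₙ), …, I(Lⱼ)` such that `j = 1` or `I(Lⱼ₋₁)` cannot be correctly reduced afterwards, and
such that no 3-ear `Lᵢ` among `Lⱼ₋₁, Lⱼ, …, Lₙ` is a cut-obstacle in the mixed graph `M i` obtained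
after reducing `I(Lₙ), …, I(Lᵢ₊₁)`. -/
def EarDecomposition.IsSuperb {V : Type u} {H : SimpleGraph V} (D : EarDecomposition H) : Prop :=
  ∃ j, 1 ≤ j ∧ j ≤ D.n ∧ ∃ M : ℕ → MixedGraph V,
    MixedGraph.IsCcr H (fun i => internalVerts (D.ear i)) D.n j M ∧
    (j = 1 ∨ ¬ (M (j - 1)).CanReduce (internalVerts (D.ear (j - 1)))) ∧
    ∀ i, 1 ≤ i → j - 1 ≤ i → i ≤ D.n → IsKEar 3 (D.ear i) →
      ¬ (M i).IsCutObstacle (internalVerts (D.ear i))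

end MixedGraphs

/-! ### Two-colourings of the faces of a connected plane graph. -/

section FaceColorings

open Module SimpleGraph

variable {V : Type u} {H : SimpleGraph V}

/-! A spherical embedding dictates all reductions: follow the faces. Facial walks use every edge
once in each direction. On the vertex set of any part `D.part i`, a mixed graph arises whose arcs
are the pieces of facial walks between leaving the part and first returning to it. Reducing the
internal vertices of an ear joins consecutive pieces of the same face, which gives the mixed graph
of the preceding part (`FaceData.exists_correctReduction`). The invariant is that forbidden arcs lie
on distinct faces. Paths cut from facial walks are correct because no face is on both sides of an
edge, `H` having no bridge (`not_sameCycle_symm`), and hence, `H` being cubic, no face passes a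
vertex twice (`eq_of_sameCycle`). So the reduction never stops, and `j = 1`.

For a 3-ear, each of the three internal vertices has at most one incoming and one outgoing arc, and
two edges join them to the preceding part. A cut-obstacle would need more than four arcs across the
boundary, so a single arc with both ends in the ear excludes it (`not_isCutObstacle`). To find that
arc (`exists_arc_within`), note that the descendant has at most two components, so two internal
vertices see the same one. This gives a closed walk through the ear and that component which avoids
the preceding part. As in the Jordan curve theorem, the walk two-colours the faces
(`exists_face_coloring`). All faces meeting the preceding part, which is connected, get one colour.
At the edge by which the walk leaves the ear both colours occur. The face of the other colour there
meets the current part only in the ear, so its piece at this edge is an arc with both ends in the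
ear. -/

theorem RotationSystem.facePerm_apply (ρ : RotationSystem H) (d : H.Dart) :
    ρ.facePerm d = ρ.next d.symm := rfl

theorem RotationSystem.facePerm_fst (ρ : RotationSystem H) (d : H.Dart) :
    (ρ.facePerm d).fst = d.snd := ρ.next_fst d.symm

theorem RotationSystem.sameCycle_next (ρ : RotationSystem H) (d : H.Dart) :
    ρ.facePerm.SameCycle d.symm (ρ.next d) :=
  ⟨1, by simp [ρ.facePerm_apply]⟩

/-- A function that is constant on rotations and invariant under reversal of darts along all walks
in a connected vertex set is constant on the darts leaving that set. -/
theorem RotationSystem.eq_of_walk {α : Type*} (ρ : RotationSystem H) (φ : H.Dart → α) {u v : V}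
    (p : H.Walk u v) (hnext : ∀ d : H.Dart, d.fst ∈ p.support → φ (ρ.next d) = φ d)
    (hsymm : ∀ d : H.Dart, d.fst ∈ p.support → φ d.symm = φ d)
    (d e : H.Dart) (hd : d.fst = u) (he : e.fst = v) : φ d = φ e := by
  have hrot : ∀ d e : H.Dart, d.fst ∈ p.support → d.fst = e.fst → φ d = φ e := by
    intro d e hd hde
    have key : ∀ (g : H.Dart), ρ.next.SameCycle d g → φ g = φ d := by
      rintro g ⟨k, rfl⟩
      have hfst : ∀ k : ℤ, ((ρ.next ^ k) d).fst = d.fst := by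
        intro k
        induction k using Int.induction_on with
        | zero => simp
        | succ k ih => rw [add_comm, zpow_add, zpow_one, Equiv.Perm.mul_apply, ρ.next_fst, ih]
        | pred k ih =>
          rw [← ih, ← ρ.next_fst ((ρ.next ^ (-(k : ℤ) - 1)) d), ← Equiv.Perm.mul_apply,
            ← zpow_one_add]
          congr 3; ring_nf
      induction k using Int.induction_on with
      | zero => simp
      | succ k ih =>
        rw [add_comm, zpow_add, zpow_one, Equiv.Perm.mul_apply, hnext _ (by rwa [hfst]), ih]
      | pred k ih =>
        rw [← ih, ← hnext ((ρ.next ^ (-(k : ℤ) - 1)) d) (by rwa [hfst]), ← Equiv.Perm.mul_apply,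
            ← zpow_one_add]
        congr 2; ring_nf
    exact (key e (ρ.sameCycle d e hde)).symm
  induction p generalizing d with
  | nil => exact hrot d e (by simp [hd]) (by rw [hd, he])
  | @cons a b c h q ih =>
    -- Rotate about `a` to the first dart of the walk, reverse it, and continue from `b`.
    let g : H.Dart := ⟨(a, b), h⟩
    rw [hrot d g (by simp [hd]) hd, ← hsymm g (by simp [g])]
    refine ih (fun d hd => hnext d ?_) (fun d hd => hsymm d ?_) g.symm rfl he
      (fun d e hd hde => hrot d e ?_ hde) <;>
    · rw [Walk.support_cons]; exact List.mem_cons_of_mem _ hd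

/-- Each step of the walk contributes one at both of its ends, so passages through `x` cancel modulo
two and only the ends of the walk remain. Hence the edge counts of a closed walk lie in the cycle
space. -/
theorem count_edges_add_parity [DecidableEq V] [Fintype H.edgeSet] (x : V) {u v : V}
    (p : H.Walk u v) :
    ∑ e : H.edgeSet, (if x ∈ (e : Sym2 V) then (p.edges.count (e : Sym2 V) : ZMod 2) else 0) =
      (if x = u then 1 else 0) + (if x = v then 1 else 0) := by
  induction p with
  | nil => simp [CharTwo.add_self_eq_zero]
  | @cons a b c h q ih =>
    have hone : ∑ e : H.edgeSet,
        (if x ∈ (e : Sym2 V) then (if s(a, b) = (e : Sym2 V) then (1 : ZMod 2) else 0) else 0) =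
        (if x = a then 1 else 0) + (if x = b then 1 else 0) := by
      rw [Finset.sum_eq_single (⟨s(a, b), h⟩ : H.edgeSet)]
      · have := h.ne
        by_cases h1 : x = a <;> by_cases h2 : x = b <;> simp_all
      · intro e _ he
        rw [if_neg (fun h' : s(a, b) = (e : Sym2 V) => he (Subtype.ext h'.symm)), ite_self]
      · simp
    have : ∀ e : H.edgeSet, (if x ∈ (e : Sym2 V) then
        (((Walk.cons h q).edges.count (e : Sym2 V) : ℕ) : ZMod 2) else 0) =
        (if x ∈ (e : Sym2 V) then (if s(a, b) = (e : Sym2 V) then (1 : ZMod 2) else 0) else 0) +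
        (if x ∈ (e : Sym2 V) then (q.edges.count (e : Sym2 V) : ZMod 2) else 0) := by
      intro e
      rw [Walk.edges_cons, List.count_cons]
      by_cases h1 : x ∈ (e : Sym2 V) <;> by_cases h2 : s(a, b) = (e : Sym2 V) <;>
        simp [h1, h2, add_comm]
    rw [Finset.sum_congr rfl (fun e _ => this e), Finset.sum_add_distrib, hone, ih]
    have h2 : ∀ t : ZMod 2, t + t = 0 := CharTwo.add_self_eq_zero
    linear_combination h2 (if x = b then 1 else 0)

open Classical in
/-- In a connected plane graph every closed walk is, modulo two, a sum of face boundaries. -/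
theorem exists_face_coloring [Finite V] (hc : H.Connected) (ρ : RotationSystem H)
    (hiso : ∀ v, ∃ w, H.Adj v w)
    (heuler : Nat.card V + ρ.numFaces = H.edgeSet.ncard + 2 * Nat.card H.ConnectedComponent)
    {a : V} (p : H.Walk a a) :
    ∃ φ : H.Dart → ZMod 2, (∀ d d', ρ.facePerm.SameCycle d d' → φ d = φ d') ∧
      ∀ d : H.Dart, φ d + φ d.symm = (p.edges.count d.edge : ZMod 2) := by
  have := Fintype.ofFinite V
  let F := Quotient (Equiv.Perm.SameCycle.setoid ρ.facePerm)
  have hF : Finite F := inferInstance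
  have := Fintype.ofFinite F
  let q : H.Dart → F := fun d => Quotient.mk _ d
  have hq : ∀ d, q d.symm = q (ρ.next d) := fun d => Quotient.sound (ρ.sameCycle_next d)
  have hcard : Nat.card V + Nat.card F = Nat.card H.edgeSet + 2 := by
    have h1 : {v : V | ∀ w, ¬ H.Adj v w} = ∅ := by
      ext v; simpa using hiso v
    have h2 : Nat.card H.ConnectedComponent = 1 := by
      have := hc.preconnected.subsingleton_connectedComponent
      have : Nonempty H.ConnectedComponent := ⟨H.connectedComponentMk a⟩
      exact Nat.card_eq_one_iff_unique.2 ⟨inferInstance, inferInstance⟩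
    rw [RotationSystem.numFaces, h1, h2, Set.ncard_empty] at heuler
    rw [Nat.card_coe_set_eq]
    exact heuler
  let M : Matrix H.edgeSet V (ZMod 2) :=
    Matrix.of fun e v => if v ∈ (e : Sym2 V) then 1 else 0
  have hMd : ∀ (g : V → ZMod 2) (d : H.Dart),
      (M.mulVec g) ⟨d.edge, d.edge_mem⟩ = g d.fst + g d.snd := by
    intro g d
    have hne := d.fst_ne_snd
    have : ∀ v : V, M ⟨d.edge, d.edge_mem⟩ v * g v =
        (if v = d.fst then g v else 0) + (if v = d.snd then g v else 0) := by
      intro v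
      have : v ∈ d.edge ↔ v = d.fst ∨ v = d.snd := Sym2.mem_iff
      by_cases h1 : v = d.fst <;> by_cases h2 : v = d.snd <;> simp_all [M]
    simp only [Matrix.mulVec, dotProduct]
    rw [Finset.sum_congr rfl (fun v _ => this v), Finset.sum_add_distrib]
    simp
  let G : (F → ZMod 2) →ₗ[ZMod 2] (H.edgeSet → ZMod 2) :=
    { toFun := fun φ e => ∑ d : H.Dart, if d.edge = e then φ (q d) else 0
      map_add' := fun φ ψ => by
        ext e
        simp only [Pi.add_apply, ← Finset.sum_add_distrib]
        exact Finset.sum_congr rfl (fun d _ => by split_ifs <;> simp)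
      map_smul' := fun c φ => by
        ext e
        simp only [Pi.smul_apply, RingHom.id_apply, Finset.smul_sum]
        exact Finset.sum_congr rfl (fun d _ => by split_ifs <;> simp) }
  have hGd : ∀ φ (d : H.Dart), G φ ⟨d.edge, d.edge_mem⟩ = φ (q d) + φ (q d.symm) := by
    intro φ d
    have : ∀ g : H.Dart, (if g.edge = d.edge then φ (q g) else 0) =
        (if g = d then φ (q g) else 0) + (if g = d.symm then φ (q g) else 0) := by
      intro g
      have hne := d.symm_ne
      have := dart_edge_eq_iff g d
      by_cases h1 : g = d <;> by_cases h2 : g = d.symm <;> simp_all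
    change ∑ g : H.Dart, (if g.edge = d.edge then φ (q g) else 0) = _
    rw [Finset.sum_congr rfl (fun g _ => this g), Finset.sum_add_distrib]
    simp
  -- A vertex function that agrees on the ends of every edge is constant, since `H` is connected. So
  -- `M` has rank at least `|V| - 1`.
  have kerM : finrank (ZMod 2) (LinearMap.ker M.mulVecLin) ≤ 1 := by
    have hle : LinearMap.ker M.mulVecLin ≤ Submodule.span (ZMod 2) {fun _ => (1 : ZMod 2)} := by
      intro g hg
      rw [Submodule.mem_span_singleton]
      refine ⟨g a, funext fun v => ?_⟩
      obtain ⟨w⟩ := hc.preconnected a v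
      have : ∀ {x y : V}, H.Walk x y → g x = g y := by
        intro x y w
        induction w with
        | nil => rfl
        | @cons x y z h w ih =>
          have := hMd g ⟨(x, y), h⟩
          rw [show M.mulVec g = 0 from hg] at this
          rw [← ih]
          exact CharTwo.add_eq_zero.1 this.symm
      simpa using this w
    exact (Submodule.finrank_mono hle).trans ((finrank_span_le_card _).trans (by simp))
  -- `G` sends a set of faces to the sum of their boundaries. A face function that agrees on the two
  -- sides of every edge is constant by `eq_of_walk`, so `G` has rank at least `|F| - 1`.
  have kerG : finrank (ZMod 2) (LinearMap.ker G) ≤ 1 := by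
    obtain ⟨b, hb⟩ := hiso a
    let d₀ : H.Dart := ⟨(a, b), hb⟩
    have hle : LinearMap.ker G ≤ Submodule.span (ZMod 2) {fun _ => (1 : ZMod 2)} := by
      intro φ hφ
      rw [Submodule.mem_span_singleton]
      refine ⟨φ (q d₀), funext fun x => ?_⟩
      obtain ⟨d, rfl⟩ := Quotient.exists_rep x
      have hs : ∀ d : H.Dart, φ (q d.symm) = φ (q d) := by
        intro d
        have := hGd φ d
        rw [show G φ = 0 from hφ] at this
        exact (CharTwo.add_eq_zero.1 this.symm).symm
      obtain ⟨w⟩ := hc.preconnected a d.fst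
      have := ρ.eq_of_walk (fun d => φ (q d)) w (fun d _ => by simp only [← hq, hs])
        (fun d _ => hs d) d₀ d rfl rfl
      simpa using this
    exact (Submodule.finrank_mono hle).trans ((finrank_span_le_card _).trans (by simp))
  have hT : ∀ x v, (M.transpose.mulVec x) v = ∑ e : H.edgeSet,
      if v ∈ (e : Sym2 V) then x e else 0 := by
    intro x v
    simp only [Matrix.mulVec, dotProduct, Matrix.transpose_apply, M, Matrix.of_apply]
    exact Finset.sum_congr rfl (fun e _ => by split_ifs <;> simp)
  -- A face enters each vertex as often as it leaves it, so face boundaries have even degree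
  -- everywhere.
  have hle : LinearMap.range G ≤ LinearMap.ker M.transpose.mulVecLin := by
    rintro _ ⟨φ, rfl⟩
    ext v
    rw [Matrix.mulVecLin_apply, hT]
    have h1 : ∑ e : H.edgeSet, (if v ∈ (e : Sym2 V) then G φ e else 0) =
        ∑ d : H.Dart, if v ∈ d.edge then φ (q d) else 0 := by
      have : ∀ e : H.edgeSet, (if v ∈ (e : Sym2 V) then G φ e else 0) =
          ∑ d : H.Dart, if d.edge = e then (if v ∈ d.edge then φ (q d) else 0) else 0 := by
        intro e
        split_ifs with hv
        · exact Finset.sum_congr rfl (fun d _ => by split_ifs with h1 h2 <;> simp_all)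
        · exact (Finset.sum_eq_zero (fun d _ => by split_ifs <;> simp_all)).symm
      rw [Finset.sum_congr rfl (fun e _ => this e), Finset.sum_comm]
      refine Finset.sum_congr rfl (fun d _ => ?_)
      rw [Finset.sum_eq_single (⟨d.edge, d.edge_mem⟩ : H.edgeSet)]
      · simp
      · intro e _ he
        rw [if_neg (fun h' => he (Subtype.ext h'.symm))]
      · simp
    have h2 : ∀ d : H.Dart, (if v ∈ d.edge then φ (q d) else 0) =
        (if v = d.fst then φ (q d) else 0) + (if v = d.snd then φ (q d) else 0) := by
      intro d
      have hne := d.fst_ne_snd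
      have : v ∈ d.edge ↔ v = d.fst ∨ v = d.snd := Sym2.mem_iff
      by_cases h1 : v = d.fst <;> by_cases h2 : v = d.snd <;> simp_all
    have h3 : ∑ d : H.Dart, (if v = d.snd then φ (q d) else 0) =
        ∑ d : H.Dart, (if v = d.fst then φ (q d) else 0) := by
      rw [← Equiv.sum_comp ρ.next (fun d => if v = d.fst then φ (q d) else 0),
        ← Equiv.sum_comp (Dart.symm_involutive (G := H)).toPerm]
      refine Finset.sum_congr rfl (fun d _ => ?_)
      simp only [Function.Involutive.coe_toPerm, ρ.next_fst, hq]
      rfl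
    rw [h1, Finset.sum_congr rfl (fun d _ => h2 d), Finset.sum_add_distrib, h3]
    exact CharTwo.add_self_eq_zero _
  -- The cycle space has dimension at most `|E| - |V| + 1`, which is `|F| - 1` by Euler's formula,
  -- and the face boundaries already span that much.
  have heq : LinearMap.range G = LinearMap.ker M.transpose.mulVecLin := by
    refine Submodule.eq_of_le_of_finrank_le hle ?_
    have r1 := LinearMap.finrank_range_add_finrank_ker G
    have r2 := LinearMap.finrank_range_add_finrank_ker M.mulVecLin
    have r3 := LinearMap.finrank_range_add_finrank_ker M.transpose.mulVecLin
    have r4 : finrank (ZMod 2) (LinearMap.range M.transpose.mulVecLin) =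
      finrank (ZMod 2) (LinearMap.range M.mulVecLin) := M.rank_transpose
    rw [finrank_fintype_fun_eq_card, ← Nat.card_eq_fintype_card] at r1 r2 r3
    omega
  have hz : (fun e : H.edgeSet => (p.edges.count (e : Sym2 V) : ZMod 2)) ∈ LinearMap.range G := by
    rw [heq, LinearMap.mem_ker]
    ext v
    rw [Matrix.mulVecLin_apply, hT, count_edges_add_parity]
    exact CharTwo.add_self_eq_zero _
  obtain ⟨φ, hφ⟩ := hz
  refine ⟨fun d => φ (q d), fun d d' h => congrArg φ (Quotient.sound h), fun d => ?_⟩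
  rw [← hGd, hφ]

end FaceColorings

/-! ### Ears, absence of bridges, and the faces of embedded cubic graphs. -/

section Ears

open SimpleGraph

variable {V : Type u} {H : SimpleGraph V}

theorem SimpleGraph.Subgraph.Connected.exists_walk {S : H.Subgraph} (hS : S.Connected) {u v : V}
    (hu : u ∈ S.verts) (hv : v ∈ S.verts) : ∃ p : H.Walk u v, ∀ w ∈ p.support, w ∈ S.verts := by
  obtain ⟨p⟩ := hS.preconnected ⟨u, hu⟩ ⟨v, hv⟩
  refine ⟨p.map S.hom, fun w hw => ?_⟩
  replace hw : w ∈ (p.map S.hom).support := hw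
  rw [Walk.support_map, List.mem_map] at hw
  obtain ⟨x, -, rfl⟩ := hw
  exact x.2

/-- Used to see that every edge of an ear has an internal end; this is why ears create no chords of
earlier parts. -/
theorem SimpleGraph.Walk.IsPath.notMem_edges_of_two_le_length {a b : V} {p : H.Walk a b}
    (hp : p.IsPath) (hl : 2 ≤ p.length) : s(a, b) ∉ p.edges := by
  cases p with
  | nil => simp
  | @cons _ x _ h q =>
    rw [Walk.cons_isPath_iff] at hp
    rw [Walk.edges_cons, List.mem_cons]
    rintro (he | he)
    · have hb : b = x := by
        have := h.ne
        rw [Sym2.eq_iff] at he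
        grind
      subst hb
      have := Walk.length_eq_zero_iff.2 (Walk.isPath_iff_nil.1 hp.1)
      rw [Walk.length_cons] at hl
      omega
    · exact hp.2 (q.fst_mem_support_of_mem_edges he)

theorem internalVerts_toSubgraph {a b : V} {p : H.Walk a b} (hp : p.IsPath) (hl : 2 ≤ p.length) :
    internalVerts p.toSubgraph = {v | v ∈ p.support ∧ v ≠ a ∧ v ≠ b} := by
  have hnil : ¬ p.Nil := by rw [Walk.not_nil_iff_lt_length]; omega
  ext v
  simp only [internalVerts, Walk.mem_verts_toSubgraph, Set.mem_ofPred_eq]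
  constructor
  · rintro ⟨hv, h2⟩
    refine ⟨hv, ?_, ?_⟩ <;> rintro rfl
    · rw [hp.neighborSet_toSubgraph_startpoint hnil] at h2
      simp at h2
    · rw [hp.neighborSet_toSubgraph_endpoint hnil] at h2
      simp at h2
  · rintro ⟨hv, ha, hb⟩
    refine ⟨hv, ?_⟩
    obtain ⟨i, rfl, hi⟩ := Walk.mem_support_iff_exists_getVert.1 hv
    rw [hp.ncard_neighborSet_toSubgraph_internal_eq_two]
    · rintro rfl; simp at ha
    · rcases hi.lt_or_eq with h | rfl
      · exact h
      · simp at hb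

theorem two_le_length_of_ncard {a b : V} {p : H.Walk a b}
    (h : 3 ≤ p.toSubgraph.verts.ncard) : 2 ≤ p.length := by
  classical
  rw [Walk.verts_toSubgraph] at h
  have : {w | w ∈ p.support}.ncard ≤ p.support.length := by
    rw [show {w | w ∈ p.support} = (p.support.toFinset : Set V) by ext; simp,
      Set.ncard_coe_finset]
    exact List.toFinset_card_le _
  rw [Walk.length_support] at this
  omega

/-- The only internal vertex of a star is its centre. -/
theorem IsStarSubgraph.internalVerts_eq {L : H.Subgraph} {c x y z : V} (hn : [c, x, y, z].Nodup)
    (hv : L.verts = {c, x, y, z}) (he : L.edgeSet = {s(c, x), s(c, y), s(c, z)}) :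
    internalVerts L = {c} := by
  have hadj : ∀ u v, L.Adj u v ↔ s(u, v) = s(c, x) ∨ s(u, v) = s(c, y) ∨ s(u, v) = s(c, z) := by
    intro u v; rw [← Subgraph.mem_edgeSet, he]; simp
  have hc : L.neighborSet c = {x, y, z} := by
    ext v
    simp only [List.nodup_cons, List.mem_cons, not_or] at hn
    rw [Subgraph.mem_neighborSet, hadj]; simp; grind
  have hleaf : ∀ v, v ≠ c → L.neighborSet v ⊆ {c} := by
    intro v hvc w
    rw [Subgraph.mem_neighborSet, hadj]
    simp only [Sym2.eq_iff, Set.mem_singleton_iff]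
    grind
  simp only [List.nodup_cons, List.mem_cons, not_or, List.not_mem_nil] at hn
  ext v
  simp only [internalVerts, Set.mem_ofPred_eq, Set.mem_singleton_iff]
  constructor
  · rintro ⟨-, h2⟩
    by_contra hne
    have := Set.ncard_le_ncard (hleaf v hne)
    rw [Set.ncard_singleton] at this
    omega
  · rintro rfl
    refine ⟨by simp [hv], ?_⟩
    rw [hc]
    calc 2 = ({x, y} : Set V).ncard := (Set.ncard_pair (by tauto)).symm
      _ ≤ _ := Set.ncard_le_ncard (by intro; simp; tauto) (by simp)

theorem IsEar.connected {L : H.Subgraph} (hL : IsEar L) : L.Connected := by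
  rcases hL with ⟨⟨a, b, p, -, rfl⟩, -⟩ | ⟨c, x, y, z, hn, hv, he⟩
  · exact p.toSubgraph_connected
  · have hcm : c ∈ L.verts := by simp [hv]
    rw [Subgraph.connected_iff]
    refine ⟨?_, ⟨c, hcm⟩⟩
    have key : ∀ u : L.verts, L.coe.Reachable ⟨c, hcm⟩ u := by
      rintro ⟨u, hu⟩
      by_cases huc : u = c
      · subst huc; exact .refl _
      · refine Adj.reachable ?_
        change L.Adj c u
        rw [← Subgraph.mem_edgeSet, he]
        rw [hv] at hu
        simp only [Set.mem_insert_iff, Set.mem_singleton_iff] at hu ⊢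
        rcases hu with h | rfl | rfl | rfl <;> tauto
    exact ⟨fun u v => (key u).symm.trans (key v)⟩

/-- Every edge of an ear lies on a path between two leaves of the ear. -/
theorem IsEar.exists_path {L : H.Subgraph} (hL : IsEar L) {u v : V} (huv : L.Adj u v) :
    ∃ (a b : V) (p : H.Walk a b), p.IsPath ∧ s(u, v) ∈ p.edges ∧
      a ∈ L.verts \ internalVerts L ∧ b ∈ L.verts \ internalVerts L ∧
      ∀ e ∈ p.edges, ∃ x ∈ e, x ∈ internalVerts L := by
  rcases hL with ⟨⟨a, b, p, hp, rfl⟩, h3⟩ | ⟨c, x, y, z, hn, hv, he⟩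
  · have hl := two_le_length_of_ncard h3
    rw [internalVerts_toSubgraph hp hl]
    refine ⟨a, b, p, hp, ?_, by simp, by simp, fun e => ?_⟩
    · rwa [← Walk.adj_toSubgraph_iff_mem_edges]
    · induction e using Sym2.ind with
      | _ s t =>
        intro hst
        have hs := p.fst_mem_support_of_mem_edges hst
        have ht := p.snd_mem_support_of_mem_edges hst
        have hne := (p.adj_of_mem_edges hst).ne
        have hab := hp.notMem_edges_of_two_le_length hl
        by_cases h : s ≠ a ∧ s ≠ b
        · exact ⟨s, by simp, hs, h⟩
        · refine ⟨t, by simp, ht, ?_, ?_⟩ <;> rintro rfl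
          · have : s = b := by tauto
            subst this
            exact hab (Sym2.eq_swap ▸ hst)
          · have : s = a := by tauto
            subst this
            exact hab hst
  · have key : ∀ x y : V, [c, x, y].Nodup → s(c, x) ∈ L.edgeSet → s(c, y) ∈ L.edgeSet →
        ∃ (a b : V) (p : H.Walk a b), p.IsPath ∧ s(c, x) ∈ p.edges ∧
        a ∈ L.verts \ internalVerts L ∧ b ∈ L.verts \ internalVerts L ∧
        ∀ e ∈ p.edges, ∃ x ∈ e, x ∈ internalVerts L := by
      intro x y hxy hx hy
      have hcx : L.Adj c x := hx
      have hcy : L.Adj c y := hy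
      simp only [List.nodup_cons, List.mem_cons, not_or, List.not_mem_nil] at hxy
      rw [IsStarSubgraph.internalVerts_eq hn hv he]
      refine ⟨x, y, .cons hcx.adj_sub.symm (.cons hcy.adj_sub .nil), ?_, ?_,
        ⟨hcx.snd_mem, ?_⟩, ⟨hcy.snd_mem, ?_⟩, ?_⟩
      · simp only [Walk.isPath_def, Walk.support_cons, Walk.support_nil, List.nodup_cons,
          List.mem_cons, not_or, List.not_mem_nil]
        tauto
      · simp [Sym2.eq_swap]
      · simp only [Set.mem_singleton_iff]; tauto
      · simp only [Set.mem_singleton_iff]; tauto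
      · simp
    have huv' : s(u, v) ∈ L.edgeSet := huv
    simp only [List.nodup_cons, List.mem_cons, not_or, List.not_mem_nil] at hn
    have hcz : s(c, z) ∈ L.edgeSet := by simp [he]
    have hcx : s(c, x) ∈ L.edgeSet := by simp [he]
    have hcy : s(c, y) ∈ L.edgeSet := by simp [he]
    rw [he] at huv'
    simp only [Set.mem_insert_iff, Set.mem_singleton_iff] at huv'
    rcases huv' with h | h | h <;> rw [h]
    · exact key x y (by simp; tauto) hcx hcy
    · exact key y x (by simp; tauto) hcy hcx
    · exact key z x (by simp; tauto) hcz hcx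

theorem IsEar.exists_leaf {L : H.Subgraph} (hL : IsEar L) : ∃ v ∈ L.verts, v ∉ internalVerts L := by
  have : ∃ u v, L.Adj u v := by
    rcases hL with ⟨⟨a, b, p, hp, rfl⟩, h3⟩ | ⟨c, x, y, z, hn, hv, he⟩
    · have hl := two_le_length_of_ncard h3
      exact ⟨a, _, p.toSubgraph_adj_snd (by rw [Walk.not_nil_iff_lt_length]; omega)⟩
    · exact ⟨c, x, by rw [← Subgraph.mem_edgeSet, he]; simp⟩
  obtain ⟨u, v, huv⟩ := this
  obtain ⟨a, b, p, -, -, ha, -⟩ := hL.exists_path huv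
  exact ⟨a, ha⟩

/-- The explicit description of an ear that is a path with three internal vertices. -/
theorem IsKEar.exists_verts {L : H.Subgraph} (hL : IsKEar 3 L) :
    ∃ a v₁ v₂ v₃ b : V, [a, v₁, v₂, v₃, b].Nodup ∧ L.Adj a v₁ ∧ L.Adj v₁ v₂ ∧ L.Adj v₂ v₃ ∧
      L.Adj v₃ b ∧ internalVerts L = {v₁, v₂, v₃} ∧
      ∀ v ∈ internalVerts L, (L.neighborSet v).ncard = 2 := by
  classical
  obtain ⟨hear, ⟨a, b, p, hp, rfl⟩, hcard⟩ := hL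
  have hl : 2 ≤ p.length := by
    by_contra hlt
    have hsub : internalVerts p.toSubgraph ⊆ (p.support.toFinset : Set V) := by
      intro v hv
      simpa using hv.1
    have := Set.ncard_le_ncard hsub
    rw [Set.ncard_coe_finset] at this
    have := List.toFinset_card_le p.support
    rw [Walk.length_support] at this
    omega
  have hI := internalVerts_toSubgraph hp hl
  have h4 : p.length = 4 := by
    have hs : internalVerts p.toSubgraph = ((p.support.toFinset.erase a).erase b : Finset V) := by
      rw [hI]; ext v; simp; tauto
    have hab : a ≠ b := by
      rintro rfl
      have := Walk.length_eq_zero_iff.2 (Walk.isPath_iff_nil.1 hp)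
      omega
    rw [hs, Set.ncard_coe_finset, Finset.card_erase_of_mem (by simp [hab.symm]),
      Finset.card_erase_of_mem (by simp), List.toFinset_card_of_nodup hp.support_nodup,
      Walk.length_support] at hcard
    omega
  have hdeg : ∀ v ∈ internalVerts p.toSubgraph, (p.toSubgraph.neighborSet v).ncard = 2 := by
    rw [hI]
    rintro v ⟨hv, ha, hb⟩
    obtain ⟨i, rfl, hi⟩ := Walk.mem_support_iff_exists_getVert.1 hv
    refine hp.ncard_neighborSet_toSubgraph_internal_eq_two ?_ (hi.lt_of_ne ?_)
    · rintro rfl; simp at ha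
    · rintro rfl; simp at hb
  match p, h4, hp, hI, hdeg with
  | .cons (v := v₁) h1 (.cons (v := v₂) h2 (.cons (v := v₃) h3 (.cons (v := b) h4 .nil))),
      _, hp, hI, hdeg =>
    have hn := hp.support_nodup
    simp only [Walk.support_cons, Walk.support_nil] at hn
    refine ⟨a, v₁, v₂, v₃, b, hn, ?_, ?_, ?_, ?_, ?_, hdeg⟩
    · simp
    · simp
    · simp
    · simp
    · rw [hI]
      ext v
      simp only [Walk.support_cons, Walk.support_nil, Set.mem_ofPred_eq, Set.mem_insert_iff,
        Set.mem_singleton_iff, List.mem_cons, List.not_mem_nil, or_false]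
      simp only [List.nodup_cons, List.mem_cons, not_or, List.not_mem_nil] at hn
      grind

namespace EarDecomposition

variable (D : EarDecomposition H)

theorem isEar {i : ℕ} (hi : i < D.n) : IsEar (D.ear (i + 1)) :=
  (D.isShortEar (i + 1) (by omega) hi).1

theorem part_verts_succ {i : ℕ} (hi : i < D.n) :
    (D.part (i + 1)).verts = (D.part i).verts ∪ (D.ear (i + 1)).verts := by
  rw [D.part_succ i hi, Subgraph.verts_sup]

theorem leaf_mem {i : ℕ} (hi : i < D.n) {v : V} (hv : v ∈ (D.ear (i + 1)).verts)
    (hv' : v ∉ internalVerts (D.ear (i + 1))) : v ∈ (D.part i).verts := by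
  have : v ∈ (D.ear (i + 1)).verts ∩ (D.part i).verts := by
    rw [D.attach i hi]; exact ⟨hv, hv'⟩
  exact this.2

theorem internalVerts_eq {i : ℕ} (hi : i < D.n) :
    internalVerts (D.ear (i + 1)) = (D.part (i + 1)).verts \ (D.part i).verts := by
  rw [D.part_verts_succ hi]
  ext v
  constructor
  · intro hv
    refine ⟨.inr hv.1, fun hv' => ?_⟩
    have : v ∈ (D.ear (i + 1)).verts ∩ (D.part i).verts := ⟨hv.1, hv'⟩
    rw [D.attach i hi] at this
    exact this.2 hv
  · rintro ⟨hv | hv, hv'⟩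
    · exact absurd hv hv'
    · by_contra h
      exact hv' (D.leaf_mem hi hv h)

theorem connected_part {i : ℕ} (hi : i ≤ D.n) : (D.part i).Connected := by
  induction i with
  | zero =>
    obtain ⟨a, p, -, h⟩ := D.part_zero
    rw [h]; exact p.toSubgraph_connected
  | succ i ih =>
    rw [D.part_succ i hi]
    refine Subgraph.connected_sup (ih (by omega)).preconnected (D.isEar hi).connected.preconnected ?_
    obtain ⟨v, hv, hv'⟩ := (D.isEar hi).exists_leaf
    exact ⟨v, D.leaf_mem hi hv hv', hv⟩

theorem connected (D : EarDecomposition H) : H.Connected := by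
  have h := D.connected_part le_rfl
  rw [D.part_last] at h
  have hne : Nonempty V := ⟨h.nonempty.some⟩
  exact ⟨fun u v => by
    obtain ⟨p, -⟩ := h.exists_walk (u := u) (v := v) trivial trivial
    exact ⟨p⟩⟩

/-- A vertex has two neighbours in the cycle or in the ear where it first appears, and later parts
only add more. In a cubic graph it follows that at most one edge at each vertex leaves the part. -/
theorem two_le_ncard_neighbors [Finite V] {i : ℕ} (hi : i ≤ D.n) {v : V}
    (hv : v ∈ (D.part i).verts) : 2 ≤ {w | H.Adj v w ∧ w ∈ (D.part i).verts}.ncard := by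
  induction i with
  | zero =>
    obtain ⟨a, p, hp, h⟩ := D.part_zero
    rw [h] at hv ⊢
    rw [← hp.ncard_neighborSet_toSubgraph_eq_two (p.mem_verts_toSubgraph.1 hv)]
    exact Set.ncard_le_ncard fun w hw => ⟨hw.adj_sub, hw.snd_mem⟩
  | succ i ih =>
    by_cases hvi : v ∈ (D.part i).verts
    · refine (ih (by omega) hvi).trans (Set.ncard_le_ncard fun w hw => ⟨hw.1, ?_⟩)
      rw [D.part_verts_succ hi]
      exact .inl hw.2
    · have : v ∈ internalVerts (D.ear (i + 1)) := by
        rw [D.internalVerts_eq hi]; exact ⟨hv, hvi⟩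
      refine this.2.trans (Set.ncard_le_ncard fun w hw => ⟨hw.adj_sub, ?_⟩)
      rw [D.part_verts_succ hi]
      exact .inr hw.snd_mem

/-- A graph with an ear decomposition has no bridge: every edge is used exactly once by some closed
walk. -/
theorem exists_closed_walk [DecidableEq V] {i : ℕ} (hi : i ≤ D.n) {u v : V}
    (huv : (D.part i).Adj u v) : ∃ (a : V) (p : H.Walk a a), p.edges.count s(u, v) = 1 := by
  induction i with
  | zero =>
    obtain ⟨a, p, hp, h⟩ := D.part_zero
    rw [h, Walk.adj_toSubgraph_iff_mem_edges] at huv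
    exact ⟨a, p, List.count_eq_one_of_mem hp.edges_nodup huv⟩
  | succ i ih =>
    rw [D.part_succ i hi, Subgraph.sup_adj] at huv
    rcases huv with h | h
    · exact ih (by omega) h
    · obtain ⟨a, b, p, hp, hpe, ha, hb, hint⟩ := (D.isEar hi).exists_path h
      obtain ⟨q, hq⟩ := (D.connected_part (by omega : i ≤ D.n)).exists_walk
        (D.leaf_mem hi hb.1 hb.2) (D.leaf_mem hi ha.1 ha.2)
      refine ⟨a, p.append q, ?_⟩
      rw [Walk.edges_append, List.count_append, List.count_eq_one_of_mem hp.edges_nodup hpe,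
        List.count_eq_zero_of_not_mem]
      intro hqe
      obtain ⟨x, hx, hx'⟩ := hint _ hpe
      rw [D.internalVerts_eq hi] at hx'
      exact hx'.2 (hq x (q.mem_support_of_mem_edges hqe hx))

end EarDecomposition

theorem SimpleGraph.IsRegularOfDegree.not_four [H.LocallyFinite] (hH : H.IsRegularOfDegree 3)
    {v a b c d : V} (ha : H.Adj v a) (hb : H.Adj v b) (hc : H.Adj v c) (hd : H.Adj v d)
    (hn : [a, b, c, d].Nodup) : False := by
  classical
  have hsub : [a, b, c, d].toFinset ⊆ H.neighborFinset v := by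
    intro x hx
    simp only [List.mem_toFinset, List.mem_cons, List.not_mem_nil, or_false] at hx
    rw [mem_neighborFinset]
    rcases hx with rfl | rfl | rfl | rfl <;> assumption
  have := Finset.card_le_card hsub
  rw [List.toFinset_card_of_nodup hn, card_neighborFinset_eq_degree, hH v] at this
  simp at this

/-- In a plane graph with an ear decomposition no face is on both sides of an edge. -/
theorem EarDecomposition.not_sameCycle_symm [Finite V] (D : EarDecomposition H)
    (ρ : RotationSystem H) (hiso : ∀ v, ∃ w, H.Adj v w)
    (heuler : Nat.card V + ρ.numFaces = H.edgeSet.ncard + 2 * Nat.card H.ConnectedComponent)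
    (d : H.Dart) : ¬ ρ.facePerm.SameCycle d d.symm := by
  classical
  intro hd
  have hadj : (D.part D.n).Adj d.fst d.snd := by rw [D.part_last]; exact d.adj
  obtain ⟨a, p, hp⟩ := D.exists_closed_walk le_rfl hadj
  -- The walk uses the edge exactly once, so the two sides of the edge differ in colour and cannot
  -- belong to one face.
  obtain ⟨φ, h1, h2⟩ := exists_face_coloring D.connected ρ hiso heuler p
  have h3 := h2 d
  rw [← h1 _ _ hd, CharTwo.add_self_eq_zero] at h3
  rw [show d.edge = s(d.fst, d.snd) from rfl] at h3
  have hp' : @List.count _ (instBEqOfDecidableEq) s(d.fst, d.snd) p.edges = 1 := by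
    convert hp
  simp_all

/-- If no face is on both sides of an edge of an embedded cubic graph, then every face passes every
vertex at most once. -/
theorem RotationSystem.eq_of_sameCycle [H.LocallyFinite] (hH : H.IsRegularOfDegree 3)
    (ρ : RotationSystem H) (hρ : ∀ d : H.Dart, ¬ ρ.facePerm.SameCycle d d.symm) {d e : H.Dart}
    (hde : ρ.facePerm.SameCycle d e) (hfst : d.fst = e.fst) : d = e := by
  -- `ρ.next d` lies on the face of `d.symm`, which is not the face of `d`.
  have key : ∀ d e, ρ.facePerm.SameCycle d e → ρ.next d ≠ e := by
    rintro d _ h rfl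
    exact hρ d (h.trans (ρ.sameCycle_next d).symm)
  have hfix : ∀ d e : H.Dart, d ≠ e → d.fst = e.fst → ρ.next d ≠ d := by
    intro d e hne hfst hd
    obtain ⟨k, hk⟩ := ρ.sameCycle d e hfst
    rw [Function.IsFixedPt.perm_zpow hd] at hk
    exact hne hk
  by_contra hne
  have hext : ∀ d e : H.Dart, d.fst = e.fst → d.snd = e.snd → d = e :=
    fun d e h1 h2 => Dart.ext _ _ (Prod.ext h1 h2)
  have f1 := ρ.next_fst d
  have f2 := ρ.next_fst e
  -- If `d ≠ e`, then `d`, `e` and their successors in the rotation are four distinct darts at a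
  -- vertex of degree three.
  refine hH.not_four (v := d.fst) d.adj (hfst ▸ e.adj) (f1 ▸ (ρ.next d).adj)
    (hfst ▸ f2 ▸ (ρ.next e).adj) ?_
  simp only [List.nodup_cons, List.mem_cons, List.not_mem_nil, or_false, not_or, not_false_eq_true,
    List.nodup_nil, and_true]
  refine ⟨⟨fun h => hne (hext _ _ hfst h), fun h => hfix d e hne hfst ?_,
    fun h => key e d hde.symm ?_⟩, ⟨fun h => key d e hde ?_, fun h => ?_⟩, fun h => ?_⟩
  · exact hext _ _ f1 h.symm
  · exact hext _ _ (f2.trans hfst.symm) h.symm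
  · exact hext _ _ (f1.trans hfst) h.symm
  · exact hfix e d (Ne.symm hne) hfst.symm (hext _ _ f2 h.symm)
  · exact hne (ρ.next.injective (hext _ _ (f1.trans (hfst.trans f2.symm)) h))

end Ears

/-! ### First-return permutations. -/

section FirstReturn

variable {α : Type*}

/-- One less than the time at which the orbit of `a` under `R` first returns to `X`. -/
noncomputable def returnTime (R : Equiv.Perm α) (X : Set α) (a : α) : ℕ :=
  sInf {k | R^[k + 1] a ∈ X}

theorem iterate_returnTime_mem [Finite α] (R : Equiv.Perm α) {X : Set α} {a : α} (ha : a ∈ X) :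
    R^[returnTime R X a + 1] a ∈ X := by
  have hne : {k | R^[k + 1] a ∈ X}.Nonempty := by
    obtain ⟨n, hn, hp⟩ := R.injective.mem_periodicPts a
    refine ⟨n - 1, ?_⟩
    have : n - 1 + 1 = n := by omega
    rw [Set.mem_ofPred_eq, this, hp.eq]
    exact ha
  exact Nat.sInf_mem hne

theorem iterate_notMem_of_lt {R : Equiv.Perm α} {X : Set α} {a : α} {j : ℕ} (h0 : j ≠ 0)
    (hj : j ≤ returnTime R X a) : R^[j] a ∉ X := by
  have : j - 1 ∉ {k | R^[k + 1] a ∈ X} := Nat.notMem_of_lt_sInf (by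
    change j - 1 < returnTime R X a; omega)
  rwa [Set.mem_ofPred_eq, Nat.sub_add_cancel (by omega)] at this

/-- Orbit stretches between consecutive visits to `X` are disjoint: cancelling the smaller exponent
puts one starting point on the stretch of the other, which avoids `X` after its start. This makes
first return injective and, later, reduction paths disjoint. -/
theorem eq_of_iterate_eq {R : Equiv.Perm α} {X : Set α} {a b : α} (ha : a ∈ X) (hb : b ∈ X)
    {j l : ℕ} (hj : j ≤ returnTime R X a) (hl : l ≤ returnTime R X b)
    (h : R^[j] a = R^[l] b) : a = b := by
  wlog hjl : j ≤ l generalizing a b j l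
  · exact (this hb ha hl hj h.symm (by omega)).symm
  obtain ⟨m, rfl⟩ := Nat.exists_eq_add_of_le hjl
  rw [Function.iterate_add_apply] at h
  have h' := R.injective.iterate j h
  by_cases hm : m = 0
  · subst hm; exact h'
  · exact absurd (h' ▸ ha) (iterate_notMem_of_lt hm (by omega))

open Classical in
/-- The permutation that maps each element of `X` to the element of `X` at which its orbit first
returns to `X`, and fixes all other elements. -/
noncomputable def firstReturn [Finite α] (R : Equiv.Perm α) (X : Set α) : Equiv.Perm α :=
  Equiv.ofBijective (fun a => if a ∈ X then R^[returnTime R X a + 1] a else a) (by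
    rw [← Finite.injective_iff_bijective]
    intro a b hab
    by_cases ha : a ∈ X <;> by_cases hb : b ∈ X <;> simp only [ha, hb, if_true, if_false] at hab
    · rw [Function.iterate_succ_apply', Function.iterate_succ_apply'] at hab
      exact eq_of_iterate_eq ha hb le_rfl le_rfl (R.injective hab)
    · exact absurd (hab ▸ iterate_returnTime_mem R ha) hb
    · exact absurd (hab ▸ iterate_returnTime_mem R hb) ha
    · exact hab)

variable [Finite α] {R : Equiv.Perm α} {X : Set α} {a : α}

theorem firstReturn_of_mem (ha : a ∈ X) : firstReturn R X a = R^[returnTime R X a + 1] a := by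
  simp [firstReturn, ha]

theorem firstReturn_of_notMem (ha : a ∉ X) : firstReturn R X a = a := by
  simp [firstReturn, ha]

theorem firstReturn_mem (ha : a ∈ X) : firstReturn R X a ∈ X := by
  rw [firstReturn_of_mem ha]; exact iterate_returnTime_mem R ha

theorem firstReturn_eq_of_mem (ha : a ∈ X) (h : R a ∈ X) : firstReturn R X a = R a := by
  have : returnTime R X a = 0 := by
    by_contra h0
    exact iterate_notMem_of_lt one_ne_zero (Nat.one_le_iff_ne_zero.2 h0) h
  rw [firstReturn_of_mem ha, this]
  rfl

end FirstReturn

/-! ### Orbits written as lists. -/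

section Lists

variable {α β : Type*}

theorem List.isChain_iterate (f : α → α) (a : α) (n : ℕ) :
    (List.iterate f a n).IsChain (fun x y => y = f x) := by
  induction n generalizing a with
  | zero => exact .nil
  | succ n ih =>
    cases n with
    | zero => exact .singleton _
    | succ n => exact .cons_cons rfl (ih (f a))

theorem List.getLast?_iterate (f : α → α) (a : α) (n : ℕ) :
    (List.iterate f a (n + 1)).getLast? = some (f^[n] a) := by
  rw [List.getLast?_eq_getElem?, List.length_iterate, Nat.add_sub_cancel,
    List.getElem?_iterate _ _ _ _ (Nat.lt_succ_self n)]

theorem List.nodup_iterate {f : α → α} {a : α} {n : ℕ}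
    (h : ∀ i < n, ∀ j < n, f^[i] a = f^[j] a → i = j) : (List.iterate f a n).Nodup := by
  rw [← List.range_map_iterate]
  exact List.nodup_range.map_on fun i hi j hj => h i (List.mem_range.1 hi) j (List.mem_range.1 hj)

end Lists

/-! ### Mixed graphs formed by pieces of facial walks. -/

section FacialMixedGraphs

open SimpleGraph Equiv.Perm

variable {V : Type u} {H : SimpleGraph V}

instance SimpleGraph.Dart.finite [Finite V] : Finite H.Dart :=
  .of_injective _ (Dart.toProd_injective (G := H))

/-- The darts that leave the vertex set `S`. -/
abbrev OutDart (H : SimpleGraph V) (S : Set V) : Type u :=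
  {d : H.Dart // d.fst ∈ S ∧ d.snd ∉ S}

/-- The data of a mixed graph on `S` whose arcs are the segments of facial walks outside `S`:
`next` maps a dart starting in `S` to the dart on the same face with which the facial walk next
leaves a vertex of `S`; forbidden arcs lie on distinct faces. -/
structure FaceData (ρ : RotationSystem H) (S : Set V) where
  next : Equiv.Perm H.Dart
  next_mem : ∀ d, d.fst ∈ S → (next d).fst ∈ S
  next_edge : ∀ d, d.fst ∈ S → d.snd ∈ S → next d = ρ.facePerm d
  sameCycle : ∀ d, ρ.facePerm.SameCycle d (next d)
  forbidden : OutDart H S → OutDart H S → Prop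
  forbidden_symm : ∀ a b, forbidden a b → forbidden b a
  not_sameCycle : ∀ a b, forbidden a b → ¬ ρ.facePerm.SameCycle a.1 b.1

/-- Every vertex of `S` has at least two neighbours in `S`. -/
def HasMinDegreeTwo (H : SimpleGraph V) (S : Set V) : Prop :=
  ∀ v ∈ S, 2 ≤ {w | H.Adj v w ∧ w ∈ S}.ncard

theorem ncard_darts_eq [H.LocallyFinite] (hH : H.IsRegularOfDegree 3) (v : V) :
    {d : H.Dart | d.fst = v}.ncard = 3 := by
  have hinj : Set.InjOn (fun d : H.Dart => d.snd) {d : H.Dart | d.fst = v} :=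
    fun d hd e he h => Dart.ext _ _ (Prod.ext (hd.trans he.symm) h)
  rw [← hinj.ncard_image]
  have : (fun d : H.Dart => d.snd) '' {d : H.Dart | d.fst = v} = (H.neighborFinset v : Set V) := by
    ext w
    simp only [Set.mem_image, Set.mem_ofPred_eq, Finset.mem_coe, mem_neighborFinset]
    constructor
    · rintro ⟨d, rfl, rfl⟩; exact d.adj
    · intro h; exact ⟨⟨(v, w), h⟩, rfl, rfl⟩
  rw [this, Set.ncard_coe_finset, card_neighborFinset_eq_degree, hH v]

namespace FaceData

variable {ρ : RotationSystem H} {S : Set V} (T : FaceData ρ S)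

theorem iterate_mem {d : H.Dart} (hd : d.fst ∈ S) (n : ℕ) : (T.next^[n] d).fst ∈ S := by
  induction n with
  | zero => exact hd
  | succ n ih => rw [Function.iterate_succ_apply']; exact T.next_mem _ ih

/-- On a finite orbit the inverse is an iterate, so the darts starting in `S` are closed under
preimages too. -/
theorem next_symm_mem [Finite V] {d : H.Dart} (hd : d.fst ∈ S) : (T.next.symm d).fst ∈ S := by
  obtain ⟨n, hn, hp⟩ := T.next.injective.mem_periodicPts d
  obtain ⟨m, rfl⟩ := Nat.exists_eq_add_one.2 hn
  have := hp.eq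
  rw [Function.iterate_succ_apply'] at this
  rw [(Equiv.symm_apply_eq T.next).2 this.symm]
  exact T.iterate_mem hd m

theorem sameCycle_iterate (d : H.Dart) (n : ℕ) : ρ.facePerm.SameCycle d (T.next^[n] d) := by
  induction n with
  | zero => exact .refl _ _
  | succ n ih => rw [Function.iterate_succ_apply']; exact ih.trans (T.sameCycle _)

theorem edges_at_eq {v : V} (hv : v ∈ S) :
    {e ∈ {e ∈ H.edgeSet | ∀ x ∈ e, x ∈ S} | v ∈ e} =
      Dart.edge '' {d : H.Dart | d.fst = v ∧ d.snd ∈ S} := by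
  ext e
  induction e using Sym2.ind with
  | _ x y =>
    simp only [Set.mem_ofPred_eq, Set.mem_image, mem_edgeSet, Sym2.mem_iff]
    constructor
    · rintro ⟨⟨h, hS⟩, rfl | rfl⟩
      · exact ⟨⟨(v, y), h⟩, ⟨rfl, hS y (.inr rfl)⟩, rfl⟩
      · exact ⟨⟨(v, x), h.symm⟩, ⟨rfl, hS x (.inl rfl)⟩, Sym2.eq_swap⟩
    · rintro ⟨d, ⟨rfl, h2⟩, he⟩
      have h' : s(d.fst, d.snd) = s(x, y) := he
      have := d.adj
      rw [Sym2.eq_iff] at h'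
      rcases h' with ⟨rfl, rfl⟩ | ⟨rfl, rfl⟩
      · refine ⟨⟨this, ?_⟩, .inl rfl⟩
        rintro z (rfl | rfl) <;> assumption
      · refine ⟨⟨this.symm, ?_⟩, .inr rfl⟩
        rintro z (rfl | rfl) <;> assumption

theorem edge_injOn {v : V} : Set.InjOn (Dart.edge (G := H)) {d : H.Dart | d.fst = v} := by
  intro d hd e he h
  rcases (dart_edge_eq_iff d e).1 h with h | h
  · exact h
  · refine absurd (?_ : e.snd = e.fst) e.snd_ne_fst
    rw [h] at hd
    exact hd.trans he.symm

theorem ncard_edges_at {v : V} (hv : v ∈ S) :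
    {e ∈ {e ∈ H.edgeSet | ∀ x ∈ e, x ∈ S} | v ∈ e}.ncard =
      {d : H.Dart | d.fst = v ∧ d.snd ∈ S}.ncard := by
  rw [edges_at_eq hv]
  exact (edge_injOn.mono fun d hd => hd.1).ncard_image

/-- The mixed graph of the segments of facial walks outside `S`. -/
def toMixedGraph [Finite V] [H.LocallyFinite] (T : FaceData ρ S) (hH : H.IsRegularOfDegree 3)
    (hS : HasMinDegreeTwo H S) : MixedGraph V where
  verts := S
  edges := {e ∈ H.edgeSet | ∀ x ∈ e, x ∈ S}
  Arc := OutDart H S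
  tail a := a.1.fst
  head a := (T.next a.1).fst
  forbidden := T.forbidden
  finite_arc := inferInstance
  forbidden_symm := T.forbidden_symm
  forbidden_irrefl a h := T.not_sameCycle a a h (.refl _ _)
  edges_not_isDiag e he := H.not_isDiag_of_mem_edgeSet he.1
  edges_subset e he := he.2
  tail_mem a := a.2.1
  head_mem a := T.next_mem _ a.2.1
  one_le_degree v hv := by
    rw [ncard_edges_at hv]
    obtain ⟨w, hw⟩ := Set.nonempty_of_ncard_ne_zero (by have := hS v hv; omega :
      {w | H.Adj v w ∧ w ∈ S}.ncard ≠ 0)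
    rw [Nat.one_le_iff_ne_zero, ← Nat.pos_iff_ne_zero, Set.ncard_pos]
    exact ⟨⟨(v, w), hw.1⟩, rfl, hw.2⟩
  degree_add_out v hv := by
    rw [ncard_edges_at hv, ← Set.ncard_image_of_injective _ Subtype.val_injective,
      ← Set.ncard_union_eq, ← ncard_darts_eq hH v]
    · congr 1
      ext d
      simp only [Set.mem_union, Set.mem_ofPred_eq, Set.mem_image, Subtype.exists, exists_and_right,
        exists_eq_right]
      grind
    · rw [Set.disjoint_left]
      rintro d hd ⟨a, -, rfl⟩
      exact a.2.2 hd.2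
  -- The preimages under `T.next` of the three darts leaving `v` all start in `S`. Each is either an
  -- edge inside `S` directed to `v` or an arc with head `v`.
  degree_add_in v hv := by
    have hsymm : {d : H.Dart | d.fst = v ∧ d.snd ∈ S}.ncard =
        {d : H.Dart | d.snd = v ∧ d.fst ∈ S}.ncard := by
      rw [← Set.ncard_image_of_injective _ (Dart.symm_involutive (G := H)).injective]
      congr 1
      ext d
      constructor
      · rintro ⟨e, he, rfl⟩; exact he
      · intro h; exact ⟨d.symm, h, d.symm_symm⟩
    rw [ncard_edges_at hv, hsymm, ← Set.ncard_image_of_injective _ Subtype.val_injective,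
      ← Set.ncard_union_eq, ← ncard_darts_eq hH v,
      ← Set.ncard_image_of_injective _ T.next.injective]
    · congr 1
      ext d
      constructor
      · rintro ⟨e, ⟨h1, h2⟩ | ⟨a, ha, rfl⟩, rfl⟩
        · rw [T.next_edge e h2 (h1 ▸ hv)]
          exact (ρ.facePerm_fst e).trans h1
        · exact ha
      · intro hd
        replace hd : d.fst = v := hd
        have hm := T.next_symm_mem (hd ▸ hv : d.fst ∈ S)
        refine ⟨T.next.symm d, ?_, by simp⟩
        by_cases hs : (T.next.symm d).snd ∈ S
        · refine .inl ⟨?_, hm⟩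
          have := T.next_edge _ hm hs
          rw [Equiv.apply_symm_apply] at this
          rw [← ρ.facePerm_fst, ← this, hd]
        · exact .inr ⟨⟨_, hm, hs⟩, by simpa using hd, rfl⟩
    · rw [Set.disjoint_left]
      rintro d hd ⟨a, -, rfl⟩
      exact a.2.2 (hd.1 ▸ hv)

end FaceData

end FacialMixedGraphs

/-! ### Correct reductions along facial walks. -/

section Reductions

open SimpleGraph Equiv.Perm MixedGraph

variable {V : Type u} {H : SimpleGraph V} [Finite V] [H.LocallyFinite]

namespace FaceData

variable {ρ : RotationSystem H} {S S' : Set V} (T : FaceData ρ S) (hH : H.IsRegularOfDegree 3)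
  (hS : HasMinDegreeTwo H S)

/-- The dart with which an arc of `A(U) ∪ Ã` starts. -/
def dart {U : Set V} (e : (T.toMixedGraph hH hS).RedArc U) : H.Dart :=
  Sum.elim (fun a => a.1.1) (fun d => ⟨d.1, d.2.1.1⟩) e

variable {T hH hS}

theorem dart_fst {U : Set V} (e : (T.toMixedGraph hH hS).RedArc U) :
    (T.dart hH hS e).fst = e.tail := by
  rcases e with a | d <;> rfl

theorem dart_fst_mem {U : Set V} (e : (T.toMixedGraph hH hS).RedArc U) :
    (T.dart hH hS e).fst ∈ S := by
  rcases e with a | d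
  · exact a.1.2.1
  · exact d.2.1.2 _ (by simp [dart])

theorem next_dart_fst {U : Set V} (e : (T.toMixedGraph hH hS).RedArc U) :
    (T.next (T.dart hH hS e)).fst = e.head := by
  rcases e with a | d
  · rfl
  · have h1 : (T.dart hH hS (.inr d : (T.toMixedGraph hH hS).RedArc U)).snd ∈ S :=
      d.2.1.2 _ (by simp [dart])
    rw [T.next_edge _ (dart_fst_mem _) h1, ρ.facePerm_fst]
    rfl

theorem dart_injective {U : Set V} :
    Function.Injective (T.dart hH hS : (T.toMixedGraph hH hS).RedArc U → H.Dart) := by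
  rintro (a | d) (b | e) h
  · exact congrArg Sum.inl (Subtype.ext (Subtype.ext h))
  · refine absurd ?_ a.1.2.2
    have h : a.1.1 = ⟨e.1, e.2.1.1⟩ := h
    rw [h]
    exact e.2.1.2 _ (by simp)
  · refine absurd ?_ b.1.2.2
    have h : ⟨d.1, d.2.1.1⟩ = b.1.1 := h
    rw [← h]
    exact d.2.1.2 _ (by simp)
  · exact congrArg Sum.inr (Subtype.ext (congrArg Dart.toProd h))

/-- Together with `dart_injective` this identifies `A(U) ∪ Ã` with the darts from `S` whose piece of
facial walk starts or ends in `U`, so that partitioning arcs becomes partitioning orbits of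
`T.next`. -/
theorem exists_dart_eq {U : Set V} {x : H.Dart} (hx : x.fst ∈ S)
    (hU : x.fst ∈ U ∨ (T.next x).fst ∈ U) :
    ∃ e : (T.toMixedGraph hH hS).RedArc U, T.dart hH hS e = x := by
  by_cases hs : x.snd ∈ S
  · refine ⟨.inr ⟨x.toProd, ⟨x.adj, ?_⟩, ?_⟩, rfl⟩
    · intro v hv
      rcases Sym2.mem_iff.1 hv with rfl | rfl <;> assumption
    · rwa [T.next_edge x hx hs, ρ.facePerm_fst] at hU
  · exact ⟨.inl ⟨⟨x, hx, hs⟩, hU⟩, rfl⟩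

theorem dart_of_isArc {U : Set V} {e : (T.toMixedGraph hH hS).RedArc U}
    {a : (T.toMixedGraph hH hS).Arc} (h : e.IsArc a) : T.dart hH hS e = a.1 := by
  obtain ⟨h, rfl⟩ := h
  rfl

/-- `P` consists of `n` consecutive segments of the facial walk through `x`, the first of which
starts with `x`. -/
def IsSegment {U : Set V} (P : List ((T.toMixedGraph hH hS).RedArc U)) (x : H.Dart) (n : ℕ) :
    Prop :=
  P.map (T.dart hH hS) = List.iterate T.next x n

theorem exists_isSegment {U : Set V} {x : H.Dart} {n : ℕ} (hx : x.fst ∈ S)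
    (h : ∀ i < n, (T.next^[i] x).fst ∈ U ∨ (T.next^[i + 1] x).fst ∈ U) :
    ∃ P : List ((T.toMixedGraph hH hS).RedArc U), IsSegment P x n := by
  have : List.iterate T.next x n ∈ Set.range
      (List.map (T.dart hH hS : (T.toMixedGraph hH hS).RedArc U → H.Dart)) := by
    rw [Set.range_list_map]
    intro y hy
    obtain ⟨i, hi, rfl⟩ := List.mem_iterate.1 hy
    refine exists_dart_eq (T.iterate_mem hx i) ?_
    rw [← Function.iterate_succ_apply' T.next]
    exact h i hi
  exact this

namespace IsSegment

variable {U : Set V} {P Q : List ((T.toMixedGraph hH hS).RedArc U)} {x y : H.Dart} {n m : ℕ}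

theorem exists_iterate (h : IsSegment P x n) {e : (T.toMixedGraph hH hS).RedArc U} (he : e ∈ P) :
    ∃ i < n, T.dart hH hS e = T.next^[i] x := by
  rw [← List.mem_iterate, ← h]
  exact List.mem_map_of_mem he

theorem exists_mem (h : IsSegment P x n) {i : ℕ} (hi : i < n) :
    ∃ e ∈ P, T.dart hH hS e = T.next^[i] x := by
  have : T.next^[i] x ∈ P.map (T.dart hH hS) := by
    rw [h, List.mem_iterate]; exact ⟨i, hi, rfl⟩
  simpa using this

theorem mem_of_dart_eq (h : IsSegment P x n) {i : ℕ} (hi : i < n)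
    {e : (T.toMixedGraph hH hS).RedArc U} (he : T.dart hH hS e = T.next^[i] x) : e ∈ P := by
  obtain ⟨g, hg, hgi⟩ := h.exists_mem hi
  rwa [dart_injective (he.trans hgi.symm)]

theorem list_eq (h : IsSegment P x n) (h' : IsSegment Q x n) : P = Q :=
  List.map_injective_iff.2 dart_injective (h.trans h'.symm)

theorem head?_tail (h : IsSegment P x (n + 1)) : P.head?.map RedArc.tail = some x.fst := by
  have : P.head?.map (T.dart hH hS) = some x := by
    rw [← List.head?_map, h]; rfl
  rw [show (RedArc.tail : (T.toMixedGraph hH hS).RedArc U → V) =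
    (fun d => d.fst) ∘ T.dart hH hS from funext fun e => (dart_fst e).symm, ← Option.map_map, this]
  rfl

theorem getLast?_head (h : IsSegment P x (n + 1)) :
    P.getLast?.map RedArc.head = some (T.next^[n + 1] x).fst := by
  have : P.getLast?.map (T.dart hH hS) = some (T.next^[n] x) := by
    rw [← List.getLast?_map, h, List.getLast?_iterate]
  rw [show (RedArc.head : (T.toMixedGraph hH hS).RedArc U → V) =
    (fun d => (T.next d).fst) ∘ T.dart hH hS from funext fun e => (next_dart_fst e).symm,
    ← Option.map_map, this, Function.iterate_succ_apply']
  rfl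

theorem exists_fst_eq (h : IsSegment P x n) {v : V} (hv : RedArc.OnVertex P v) :
    ∃ i ≤ n, v = (T.next^[i] x).fst := by
  obtain ⟨e, he, hv⟩ := hv
  obtain ⟨i, hi, hei⟩ := h.exists_iterate he
  rcases hv with rfl | rfl
  · exact ⟨i, hi.le, by rw [← dart_fst, hei]⟩
  · exact ⟨i + 1, hi, by rw [← next_dart_fst, hei, ← Function.iterate_succ_apply' T.next]⟩

theorem sameCycle_of_onArc (h : IsSegment P x n) {a : (T.toMixedGraph hH hS).Arc}
    (ha : RedArc.OnArc P a) : ρ.facePerm.SameCycle x a.1 := by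
  obtain ⟨e, he, hea⟩ := ha
  obtain ⟨i, -, hi⟩ := h.exists_iterate he
  rw [← dart_of_isArc hea, hi]
  exact T.sameCycle_iterate x i

theorem nodup (h : IsSegment P x n)
    (hn : ∀ i < n, ∀ j < n, T.next^[i] x = T.next^[j] x → i = j) : P.Nodup :=
  List.Nodup.of_map (T.dart hH hS) (by rw [h]; exact List.nodup_iterate hn)

/-- If no face is on both sides of an edge, segments of facial walks are correct. -/
theorem isDipath_and_isCorrect (hρ : ∀ d : H.Dart, ¬ ρ.facePerm.SameCycle d d.symm)
    (h : IsSegment P x n) (h0 : n ≠ 0)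
    (hn : ∀ i < n, ∀ j < n, T.next^[i] x = T.next^[j] x → i = j) :
    RedArc.IsDipath P ∧ RedArc.IsCorrect P := by
  have hface : ∀ e ∈ P, ρ.facePerm.SameCycle x (T.dart hH hS e) := by
    intro e he
    obtain ⟨i, -, hi⟩ := h.exists_iterate he
    rw [hi]
    exact T.sameCycle_iterate x i
  have hP := h.nodup hn
  refine ⟨⟨?_, ?_, ?_, ?_⟩, ?_, ?_⟩
  · rintro rfl
    have := congrArg List.length h
    simp at this
    exact h0 this.symm
  · have hc := List.isChain_iterate T.next x n
    rw [← h, List.isChain_map] at hc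
    refine hc.imp fun e g heg => ?_
    rw [← dart_fst, heg, next_dart_fst]
  -- A face passes each vertex at most once, so a repeated tail would be a repeated dart.
  · refine hP.map_on fun e he g hg heg => dart_injective ?_
    rw [← dart_fst, ← dart_fst] at heg
    exact ρ.eq_of_sameCycle hH hρ ((hface e he).symm.trans (hface g hg)) heg
  · refine hP.map_on fun e he g hg heg => dart_injective (T.next.injective ?_)
    rw [← next_dart_fst, ← next_dart_fst] at heg
    exact ρ.eq_of_sameCycle hH hρ (((hface e he).trans (T.sameCycle _)).symm.trans
      ((hface g hg).trans (T.sameCycle _))) heg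
  · intro a b ha hb hab
    exact T.not_sameCycle a b hab ((h.sameCycle_of_onArc ha).symm.trans (h.sameCycle_of_onArc hb))
  · rintro ⟨hl, hcl, hedge⟩
    have h2 : n = 2 := by
      have := congrArg List.length h
      simp only [List.length_map, List.length_iterate] at this
      omega
    subst h2
    -- On edges inside `S`, `T.next` is plain face tracing. A closed walk of two edges would
    -- therefore turn from `x` straight into `x.symm`, putting one face on both sides of an edge.
    have hedge' : ∀ i < 2, T.next (T.next^[i] x) = ρ.facePerm (T.next^[i] x) := by
      intro i hi
      obtain ⟨e, he, hei⟩ := h.exists_mem hi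
      obtain ⟨d, rfl⟩ := hedge e he
      rw [← hei]
      exact T.next_edge _ (d.2.1.2 _ (by simp [dart])) (d.2.1.2 _ (by simp [dart]))
    rw [RedArc.IsClosed, h.getLast?_head, h.head?_tail, Option.some_inj] at hcl
    have e0 : T.next x = ρ.facePerm x := hedge' 0 (by omega)
    have e1 : T.next (T.next x) = ρ.facePerm (T.next x) := hedge' 1 (by omega)
    change (T.next (T.next x)).fst = x.fst at hcl
    rw [e1, ρ.facePerm_fst, e0] at hcl
    refine hρ x ?_
    have : ρ.facePerm x = x.symm := Dart.ext _ _ (Prod.ext (ρ.facePerm_fst x) hcl)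
    rw [← this]
    exact ⟨1, by simp⟩

end IsSegment

end FaceData

/-- The darts that start in the vertex set `S`. -/
def dartsFrom (H : SimpleGraph V) (S : Set V) : Set H.Dart := {d | d.fst ∈ S}

namespace FaceData

variable {ρ : RotationSystem H} {S S' : Set V} {T : FaceData ρ S} {hH : H.IsRegularOfDegree 3}
  {hS : HasMinDegreeTwo H S}

/-- `P` is the part of a facial walk that starts with `x` in `S'`, passes through `S \ S'`, and
ends when it first returns to `S'`. -/
structure IsReductionPath (S' : Set V) (P : List ((T.toMixedGraph hH hS).RedArc (S \ S')))
    (x : H.Dart) : Prop where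
  fst_mem : x ∈ dartsFrom H S'
  next_notMem : T.next x ∉ dartsFrom H S'
  isSegment : IsSegment P x (returnTime T.next (dartsFrom H S') x + 1)

/-- `C` is a facial walk all of whose vertices in `S` lie in `S \ S'`, listed from a starting point
`x` that depends only on the facial walk. -/
structure IsReductionCycle (S' : Set V) (C : List ((T.toMixedGraph hH hS).RedArc (S \ S')))
    (x : H.Dart) : Prop where
  fst_mem : x ∈ dartsFrom H S
  iterate_notMem : ∀ k, T.next^[k] x ∉ dartsFrom H S'
  out_eq : (Quotient.mk (SameCycle.setoid T.next) x).out = x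
  isSegment : IsSegment C x (Function.minimalPeriod T.next x)

theorem exists_isReductionPath (hsub : S' ⊆ S) {x : H.Dart} (hx : x ∈ dartsFrom H S')
    (hx' : T.next x ∉ dartsFrom H S') :
    ∃ P : List ((T.toMixedGraph hH hS).RedArc (S \ S')), IsReductionPath S' P x := by
  obtain ⟨P, hP⟩ := exists_isSegment (U := S \ S') (T := T) (hH := hH) (hS := hS) (x := x)
    (n := returnTime T.next (dartsFrom H S') x + 1) (hsub hx) (fun i hi => by
      by_cases h0 : i = 0
      · subst h0
        exact .inr ⟨T.next_mem x (hsub hx), hx'⟩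
      · exact .inl ⟨T.iterate_mem (hsub hx) i, iterate_notMem_of_lt (X := dartsFrom H S') h0
          (Nat.lt_succ_iff.1 hi)⟩)
  exact ⟨P, hx, hx', hP⟩

namespace IsReductionPath

variable {P Q : List ((T.toMixedGraph hH hS).RedArc (S \ S'))} {x y : H.Dart}

theorem nodup (h : IsReductionPath S' P x) :
    ∀ i < returnTime T.next (dartsFrom H S') x + 1, ∀ j < returnTime T.next (dartsFrom H S') x + 1,
      T.next^[i] x = T.next^[j] x → i = j := by
  intro i hi j hj hij
  wlog hle : i ≤ j generalizing i j
  · exact (this j hj i hi hij.symm (by omega)).symm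
  obtain ⟨m, rfl⟩ := Nat.exists_eq_add_of_le hle
  by_contra hne
  rw [Function.iterate_add_apply] at hij
  refine iterate_notMem_of_lt (R := T.next) (X := dartsFrom H S') (a := x) (j := m) (by omega)
    (by omega) ?_
  rw [← T.next.injective.iterate i hij]
  exact h.fst_mem

theorem list_eq (h : IsReductionPath S' P x) (h' : IsReductionPath S' Q x) : P = Q :=
  h.isSegment.list_eq h'.isSegment

theorem start_eq (h : IsReductionPath S' P x) (h' : IsReductionPath S' P y) : x = y := by
  obtain ⟨e, he, hx⟩ := h.isSegment.exists_mem (Nat.succ_pos _)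
  obtain ⟨j, hj, hy⟩ := h'.isSegment.exists_iterate he
  exact eq_of_iterate_eq h.fst_mem h'.fst_mem (Nat.zero_le _) (Nat.lt_succ_iff.1 hj)
    (hx.symm.trans hy)

theorem isCorrectPath (hρ : ∀ d : H.Dart, ¬ ρ.facePerm.SameCycle d d.symm)
    (h : IsReductionPath S' P x) : RedArc.IsCorrectPath P := by
  obtain ⟨h1, h2⟩ := h.isSegment.isDipath_and_isCorrect hρ (Nat.succ_ne_zero _) h.nodup
  refine ⟨h1, h2, ?_, ?_⟩
  · intro e he hU
    have := h.isSegment.head?_tail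
    rw [Option.mem_def.1 he, Option.map_some, Option.some_inj] at this
    rw [this] at hU
    exact hU.2 h.fst_mem
  · intro e he hU
    have := h.isSegment.getLast?_head
    rw [Option.mem_def.1 he, Option.map_some, Option.some_inj] at this
    rw [this] at hU
    exact hU.2 (iterate_returnTime_mem T.next h.fst_mem)

theorem eq_of_mem (h : IsReductionPath S' P x) (h' : IsReductionPath S' Q y)
    {e : (T.toMixedGraph hH hS).RedArc (S \ S')} (he : e ∈ P) (he' : e ∈ Q) : P = Q := by
  obtain ⟨i, hi, hx⟩ := h.isSegment.exists_iterate he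
  obtain ⟨j, hj, hy⟩ := h'.isSegment.exists_iterate he'
  have := eq_of_iterate_eq h.fst_mem h'.fst_mem (Nat.lt_succ_iff.1 hi) (Nat.lt_succ_iff.1 hj)
    (hx.symm.trans hy)
  subst this
  exact h.list_eq h'

/-- After an edge inside `S'` the facial walk continues from `S'` at once. Thus the starting dart of
a reduction path is an arc of the smaller mixed graph. -/
theorem snd_notMem (hsub : S' ⊆ S) (h : IsReductionPath S' P x) : x.snd ∉ S' := by
  intro hs
  refine h.next_notMem ?_
  rw [T.next_edge x (hsub h.fst_mem) (hsub hs)]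
  change (ρ.facePerm x).fst ∈ S'
  rwa [ρ.facePerm_fst]

/-- The segment after a reduction path on the same facial walk is not a reduction path. -/
theorem iterate_ne (hsub : S' ⊆ S) (hS' : HasMinDegreeTwo H S')
    (hρ : ∀ d : H.Dart, ¬ ρ.facePerm.SameCycle d d.symm) (h : IsReductionPath S' P x)
    (h' : IsReductionPath S' Q y) : T.next^[returnTime T.next (dartsFrom H S') x + 1] x ≠ y := by
  intro hxy
  rw [Function.iterate_succ_apply'] at hxy
  set w := T.next^[returnTime T.next (dartsFrom H S') x] x with hw
  -- `w'` is the dart just before `y` on the face. If it starts in `S'`, the path from `x` is a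
  -- single edge or arc returning to `S'` at once, against `next_notMem`.
  obtain ⟨w', hw'⟩ := ρ.facePerm.surjective y
  have hsnd : w'.snd = y.fst := by rw [← hw', ρ.facePerm_fst]
  have hyS' : y.fst ∈ S' := h'.fst_mem
  by_cases hm : w'.fst ∈ S'
  · have : T.next w' = T.next w := by
      rw [T.next_edge w' (hsub hm) (hsub (hsnd ▸ hyS')), hw', hxy]
    have hww := T.next.injective this
    have h0 : returnTime T.next (dartsFrom H S') x = 0 := by
      by_contra h0
      refine iterate_notMem_of_lt h0 le_rfl ?_
      rw [← hw, ← hww]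
      exact hm
    rw [h0] at hw
    refine h.next_notMem ?_
    rw [← show w = x from hw, hxy]
    exact hyS'
  -- Otherwise `y.fst` has two neighbours in `S'` and two distinct ones outside, `y.snd` and
  -- `w'.fst`.
  · obtain ⟨a, ha, b, hb, hab⟩ := (Set.one_lt_ncard (Set.toFinite _)).1 (hS' y.fst hyS')
    have hy := h'.snd_notMem hsub
    have hadj : H.Adj y.fst w'.fst := hsnd ▸ w'.adj.symm
    refine hH.not_four ha.1 hb.1 y.adj hadj ?_
    have hne : y.snd ≠ w'.fst := by
      intro hne
      have : y = w'.symm := Dart.ext _ _ (Prod.ext hsnd.symm hne)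
      refine hρ w' ?_
      rw [← this, ← hw']
      exact ⟨1, by simp⟩
    have := ha.2
    have := hb.2
    simp only [List.nodup_cons, List.mem_cons, List.not_mem_nil, or_false, not_or,
      not_false_eq_true, List.nodup_nil, and_true]
    refine ⟨⟨hab, ?_, ?_⟩, ⟨?_, ?_⟩, hne⟩ <;> rintro rfl <;> contradiction

/-- Reduction paths with a common vertex lie on distinct faces. -/
theorem eq_of_onVertex (hsub : S' ⊆ S) (hS' : HasMinDegreeTwo H S')
    (hρ : ∀ d : H.Dart, ¬ ρ.facePerm.SameCycle d d.symm) (h : IsReductionPath S' P x)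
    (h' : IsReductionPath S' Q y) (hxy : ρ.facePerm.SameCycle x y) {v : V}
    (hv : RedArc.OnVertex P v) (hv' : RedArc.OnVertex Q v) : x = y := by
  obtain ⟨i, hi, hvi⟩ := h.isSegment.exists_fst_eq hv
  obtain ⟨j, hj, hvj⟩ := h'.isSegment.exists_fst_eq hv'
  have key : T.next^[i] x = T.next^[j] y :=
    ρ.eq_of_sameCycle hH hρ (((T.sameCycle_iterate x i).symm.trans hxy).trans
      (T.sameCycle_iterate y j)) (hvi.symm.trans hvj)
  -- A common vertex on one face is a common dart, so only end positions need care: the end of a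
  -- path is not an inner dart of another, since these avoid `S'`, and not its start, by
  -- `iterate_ne`.
  have last : ∀ {P Q : List ((T.toMixedGraph hH hS).RedArc (S \ S'))} {x y : H.Dart} {j : ℕ},
      IsReductionPath S' P x → IsReductionPath S' Q y →
      j ≤ returnTime T.next (dartsFrom H S') y →
      T.next^[returnTime T.next (dartsFrom H S') x + 1] x ≠ T.next^[j] y := by
    intro P Q x y j h h' hj heq
    by_cases h0 : j = 0
    · subst h0
      exact h.iterate_ne hsub hS' hρ h' heq
    · exact iterate_notMem_of_lt h0 hj (heq ▸ iterate_returnTime_mem T.next h.fst_mem)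
  rcases hi.lt_or_eq with hi | rfl <;> rcases hj.lt_or_eq with hj | rfl
  · exact eq_of_iterate_eq h.fst_mem h'.fst_mem (by omega) (by omega) key
  · exact absurd key.symm (last h' h (by omega))
  · exact absurd key (last h h' (by omega))
  · rw [Function.iterate_succ_apply', Function.iterate_succ_apply'] at key
    exact eq_of_iterate_eq h.fst_mem h'.fst_mem le_rfl le_rfl (T.next.injective key)

end IsReductionPath

theorem IsReductionCycle.isCorrectCycle (hρ : ∀ d : H.Dart, ¬ ρ.facePerm.SameCycle d d.symm)
    {C : List ((T.toMixedGraph hH hS).RedArc (S \ S'))} {x : H.Dart}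
    (h : IsReductionCycle S' C x) : RedArc.IsCorrectCycle C := by
  have hpos := Function.minimalPeriod_pos_of_mem_periodicPts (T.next.injective.mem_periodicPts x)
  obtain ⟨m, hm⟩ := Nat.exists_eq_add_one.2 hpos
  have hseg := h.isSegment
  obtain ⟨h1, h2⟩ := hseg.isDipath_and_isCorrect hρ hpos.ne' (fun i hi j hj hij =>
    Function.iterate_injOn_Iio_minimalPeriod hi hj hij)
  refine ⟨h1, ?_, h2⟩
  have hper := Function.iterate_minimalPeriod (f := T.next) (x := x)
  rw [hm] at hseg hper
  rw [RedArc.IsClosed, hseg.getLast?_head, hseg.head?_tail, hper]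

/-- Every arc to be reduced lies on a reduction path or on a reduction cycle, and on only one. -/
theorem exists_unique_list (hsub : S' ⊆ S) (e : (T.toMixedGraph hH hS).RedArc (S \ S')) :
    ∃! P, P ∈ {P | ∃ x, IsReductionPath (T := T) (hH := hH) (hS := hS) S' P x} ∪
      {C | ∃ x, IsReductionCycle (T := T) (hH := hH) (hS := hS) S' C x} ∧ e ∈ P := by
  classical
  have hdisj : ∀ {P C : List ((T.toMixedGraph hH hS).RedArc (S \ S'))} {x y : H.Dart},
      IsReductionPath S' P x → IsReductionCycle S' C y → e ∈ P → e ∈ C → False := by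
    intro P C x y hP hC h1 h2
    obtain ⟨i, hi, hx⟩ := hP.isSegment.exists_iterate h1
    obtain ⟨j, hj, hy⟩ := hC.isSegment.exists_iterate h2
    obtain ⟨m, hm⟩ := Nat.exists_eq_add_of_lt hi
    refine hC.iterate_notMem (m + 1 + j) ?_
    rw [Function.iterate_add_apply, ← hy, hx, ← Function.iterate_add_apply,
      show m + 1 + i = returnTime T.next (dartsFrom H S') x + 1 by omega]
    exact iterate_returnTime_mem T.next hP.fst_mem
  have hcyc : ∀ {C C' : List ((T.toMixedGraph hH hS).RedArc (S \ S'))} {x y : H.Dart},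
      IsReductionCycle S' C x → IsReductionCycle S' C' y → e ∈ C → e ∈ C' → C = C' := by
    intro C C' x y hC hC' h1 h2
    obtain ⟨i, hi, hx⟩ := hC.isSegment.exists_iterate h1
    obtain ⟨j, hj, hy⟩ := hC'.isSegment.exists_iterate h2
    have hs : T.next.SameCycle x y := by
      have h1 : T.next.SameCycle x (T.next^[i] x) := ⟨i, by simp [iterate_eq_pow]⟩
      have h2 : T.next.SameCycle y (T.next^[j] y) := ⟨j, by simp [iterate_eq_pow]⟩
      rw [← hx] at h1
      rw [← hy] at h2
      exact h1.trans h2.symm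
    have hxy : x = y := by
      rw [← hC.out_eq, ← hC'.out_eq]
      exact congrArg Quotient.out (Quotient.sound hs)
    subst hxy
    exact hC.isSegment.list_eq hC'.isSegment
  have hex : ∃ P, P ∈ {P | ∃ x, IsReductionPath (T := T) (hH := hH) (hS := hS) S' P x} ∪
      {C | ∃ x, IsReductionCycle (T := T) (hH := hH) (hS := hS) S' C x} ∧ e ∈ P := by
    set z := T.dart hH hS e with hz
    -- Orbits meeting `S'` are cut into reduction paths at their visits; the remaining orbits are
    -- reduction cycles.
    by_cases hret : ∃ k, T.next^[k] z ∈ dartsFrom H S'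
    · have hback : ∃ j, ∃ y ∈ dartsFrom H S', T.next^[j] y = z := by
        obtain ⟨k, hk⟩ := hret
        have hs : T.next.SameCycle (T.next^[k] z) z := (show T.next.SameCycle z _ from
          ⟨k, by simp [iterate_eq_pow]⟩).symm
        obtain ⟨j, -, hj⟩ := hs.exists_pow_eq'
        exact ⟨j, _, hk, by rwa [iterate_eq_pow T.next j]⟩
      -- The least number of backward steps yields the last visit `y` to `S'` up to `z`, where the
      -- path through `e` starts.
      obtain ⟨y, hy, hyz⟩ := Nat.find_spec hback
      have hmin := fun m => Nat.find_min (m := m) hback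
      set j := Nat.find hback
      have hnot : ∀ i, i ≠ 0 → i ≤ j → T.next^[i] y ∉ dartsFrom H S' := by
        intro i hi hij hmem
        refine hmin (j - i) (by omega) ⟨_, hmem, ?_⟩
        rw [← Function.iterate_add_apply, Nat.sub_add_cancel hij, hyz]
      have hjle : j ≤ returnTime T.next (dartsFrom H S') y := by
        by_contra hlt
        exact hnot _ (Nat.succ_ne_zero _) (by omega) (iterate_returnTime_mem T.next hy)
      have hnext : T.next y ∉ dartsFrom H S' := by
        -- If `e` itself starts in `S'`, it must end outside `S'`, because it is incident with the
        -- reduced set.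
        by_cases h0 : j = 0
        · rw [h0] at hyz
          have hyz' : y = z := hyz
          rw [hyz'] at hy ⊢
          intro hmem
          have h1 : e.tail ∈ S' := by rw [← dart_fst]; exact hy
          have h2 : e.head ∈ S' := by rw [← next_dart_fst]; exact hmem
          rcases e with a | d
          · rcases a.2 with h | h
            · exact h.2 h1
            · exact h.2 h2
          · rcases d.2.2 with h | h
            · exact h.2 h1
            · exact h.2 h2
        · exact hnot 1 one_ne_zero (by omega)
      obtain ⟨P, hP⟩ := exists_isReductionPath (hH := hH) (hS := hS) hsub hy hnext
      exact ⟨P, .inl ⟨y, hP⟩, hP.isSegment.mem_of_dart_eq (Nat.lt_succ_iff.2 hjle) hyz.symm⟩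
    -- A canonical starting dart for each orbit prevents cyclic shifts of one cycle from counting as
    -- different lists.
    · set x := (Quotient.mk (SameCycle.setoid T.next) z).out with hx
      have hxz : T.next.SameCycle x z := Quotient.mk_out (s := SameCycle.setoid T.next) z
      have hper := T.next.injective.mem_periodicPts x
      obtain ⟨l, -, hl⟩ := hxz.symm.exists_pow_eq'
      replace hl : T.next^[l] z = x := by rwa [iterate_eq_pow]
      obtain ⟨i, -, hi⟩ := hxz.exists_pow_eq'
      replace hi : T.next^[i] x = z := by rwa [iterate_eq_pow]
      rw [← Function.iterate_mod_minimalPeriod_eq] at hi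
      have hfst : x.fst ∈ S := by
        rw [← hl]; exact T.iterate_mem (dart_fst_mem e) l
      have hno : ∀ k, T.next^[k] x ∉ dartsFrom H S' := by
        intro k hk
        refine hret ⟨k + l, ?_⟩
        rwa [Function.iterate_add_apply, hl]
      obtain ⟨C, hC⟩ := exists_isSegment (U := S \ S') (T := T) (hH := hH) (hS := hS) (x := x)
        (n := Function.minimalPeriod T.next x) hfst
        (fun i _ => .inl ⟨T.iterate_mem hfst i, hno i⟩)
      refine ⟨C, .inr ⟨x, hfst, hno, ?_, hC⟩, hC.mem_of_dart_eq (Nat.mod_lt _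
        (Function.minimalPeriod_pos_of_mem_periodicPts hper)) hi.symm⟩
      rw [hx, Quotient.out_eq]
  obtain ⟨P, hP, heP⟩ := hex
  refine ⟨P, ⟨hP, heP⟩, ?_⟩
  rintro Q ⟨hQ, heQ⟩
  rcases hP with ⟨x, hP⟩ | ⟨x, hP⟩ <;> rcases hQ with ⟨y, hQ⟩ | ⟨y, hQ⟩
  · exact hQ.eq_of_mem hP heQ heP
  · exact (hdisj hP hQ heP heQ).elim
  · exact (hdisj hQ hP heQ heP).elim
  · exact hcyc hQ hP heQ heP

end FaceData

namespace FaceData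

variable {ρ : RotationSystem H} {S S' : Set V} {T : FaceData ρ S} {hH : H.IsRegularOfDegree 3}
  {hS : HasMinDegreeTwo H S}

variable (T hH hS S') in
/-- The arcs after a reduction: the arcs that are not affected, and the reduction paths. -/
abbrev NewArc : Type u :=
  {a : (T.toMixedGraph hH hS).Arc // (T.toMixedGraph hH hS).tail a ∉ S \ S' ∧
    (T.toMixedGraph hH hS).head a ∉ S \ S'} ⊕
  ({P | ∃ x, IsReductionPath S' P x} : Set (List ((T.toMixedGraph hH hS).RedArc (S \ S'))))

/-- A dart leaving `S'` either already starts an arc that returns to `S'`, which is then an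
unaffected arc, or starts a reduction path. Representing each new arc by its starting dart lets the
construction be iterated. -/
theorem exists_newArc_equiv (hsub : S' ⊆ S) :
    ∃ E : NewArc S' T hH hS ≃ OutDart H S', (∀ a, (E (.inl a)).1 = a.1.1) ∧
      ∀ P, IsReductionPath S' P.1 (E (.inr P)).1 := by
  have hold : ∀ a : (T.toMixedGraph hH hS).Arc, (T.toMixedGraph hH hS).tail a ∉ S \ S' →
      a.1.fst ∈ S' ∧ a.1.snd ∉ S' := by
    intro a ha
    refine ⟨by_contra fun h => ha ⟨a.2.1, h⟩, fun h => a.2.2 (hsub h)⟩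
  let g : NewArc S' T hH hS → OutDart H S' := Sum.elim
    (fun a => ⟨a.1.1, hold a.1 a.2.1⟩)
    (fun P => ⟨P.2.choose, P.2.choose_spec.fst_mem, P.2.choose_spec.snd_notMem hsub⟩)
  have hinr : ∀ P, IsReductionPath S' P.1 (g (.inr P)).1 := fun P => P.2.choose_spec
  have hmix : ∀ a P, g (.inl a) ≠ g (.inr P) := by
    intro a P h
    have h1 : a.1.1 = (g (.inr P)).1 := congrArg Subtype.val h
    have h2 := (hinr P).next_notMem
    rw [← h1] at h2
    exact a.2.2 ⟨T.next_mem _ a.1.2.1, h2⟩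
  have hbij : Function.Bijective g := by
    constructor
    · rintro (a | P) (b | Q) h
      · have h' : a.1.1 = b.1.1 := congrArg (fun o : OutDart H S' => o.1) h
        exact congrArg Sum.inl (Subtype.ext (Subtype.ext h'))
      · exact absurd h (hmix a Q)
      · exact absurd h.symm (hmix b P)
      · have h1 := hinr P
        rw [h] at h1
        exact congrArg Sum.inr (Subtype.ext (h1.list_eq (hinr Q)))
    · rintro ⟨d, hd, hd'⟩
      by_cases hn : (T.next d).fst ∈ S'
      · have hs : d.snd ∉ S := by
          intro hs
          rw [T.next_edge d (hsub hd) hs, ρ.facePerm_fst] at hn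
          exact hd' hn
        exact ⟨.inl ⟨⟨d, hsub hd, hs⟩, fun h => h.2 hd, fun h => h.2 hn⟩, rfl⟩
      · obtain ⟨P, hP⟩ := exists_isReductionPath (hH := hH) (hS := hS) hsub (x := d) hd hn
        exact ⟨.inr ⟨P, d, hP⟩, Subtype.ext ((hinr ⟨P, d, hP⟩).start_eq hP)⟩
  exact ⟨Equiv.ofBijective g hbij, fun a => rfl, hinr⟩

/-- The forbidden pairs of arcs after a reduction. -/
def newForbidden : NewArc S' T hH hS → NewArc S' T hH hS → Prop
  | .inl a, .inl b => T.forbidden a.1 b.1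
  | .inr P, .inl b => ∃ a, RedArc.OnArc P.1 a ∧ T.forbidden a b.1
  | .inl a, .inr Q => ∃ b, RedArc.OnArc Q.1 b ∧ T.forbidden b a.1
  | .inr P, .inr Q => P ≠ Q ∧ ((∃ v, RedArc.OnVertex P.1 v ∧ RedArc.OnVertex Q.1 v) ∨
      ∃ a b, RedArc.OnArc P.1 a ∧ RedArc.OnArc Q.1 b ∧ T.forbidden a b)

theorem newForbidden_symm :
    ∀ a b : NewArc S' T hH hS, newForbidden a b → newForbidden b a
  | .inl _, .inl _, h => T.forbidden_symm _ _ h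
  | .inr _, .inl _, h => h
  | .inl _, .inr _, h => h
  | .inr _, .inr _, ⟨hne, .inl ⟨v, h1, h2⟩⟩ => ⟨hne.symm, .inl ⟨v, h2, h1⟩⟩
  | .inr _, .inr _, ⟨hne, .inr ⟨a, b, h1, h2, h⟩⟩ =>
    ⟨hne.symm, .inr ⟨b, a, h2, h1, T.forbidden_symm _ _ h⟩⟩

/-- The segments of facial walks outside `S` can be correctly reduced to the segments of facial
walks outside a smaller set `S'`. -/
theorem exists_correctReduction (T : FaceData ρ S) (hsub : S' ⊆ S) (hS' : HasMinDegreeTwo H S')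
    (hρ : ∀ d : H.Dart, ¬ ρ.facePerm.SameCycle d d.symm) :
    ∃ T' : FaceData ρ S', Nonempty (CorrectReduction (T.toMixedGraph hH hS) (S \ S')
      (T'.toMixedGraph hH hS')) := by
  obtain ⟨E, hinl, hinr⟩ := exists_newArc_equiv (T := T) (hH := hH) (hS := hS) hsub
  have hmixed : ∀ P b, newForbidden (.inr P : NewArc S' T hH hS) (.inl b) →
      ¬ ρ.facePerm.SameCycle (E (.inr P)).1 (E (.inl b)).1 := by
    rintro P b ⟨a, ha, hab⟩ h
    rw [hinl] at h
    exact T.not_sameCycle a b.1 hab (((hinr P).isSegment.sameCycle_of_onArc ha).symm.trans h)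
  have hforb : ∀ a b : NewArc S' T hH hS, newForbidden a b →
      ¬ ρ.facePerm.SameCycle (E a).1 (E b).1 := by
    rintro (a | P) (b | Q) hab h
    · rw [hinl, hinl] at h
      exact T.not_sameCycle a.1 b.1 hab h
    · exact hmixed Q a hab h.symm
    · exact hmixed P b hab h
    -- Two distinct paths on one face share no vertex, and an inherited forbidden pair already lies
    -- on distinct faces; so the invariant survives.
    · obtain ⟨hne, ⟨v, h1, h2⟩ | ⟨a, b, h1, h2, hab⟩⟩ := hab
      · have := (hinr P).eq_of_onVertex hsub hS' hρ (hinr Q) h h1 h2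
        exact hne (Sum.inr_injective (E.injective (Subtype.ext this)))
      · exact T.not_sameCycle a b hab ((((hinr P).isSegment.sameCycle_of_onArc h1).symm.trans
          h).trans ((hinr Q).isSegment.sameCycle_of_onArc h2))
  let T' : FaceData ρ S' :=
    { next := firstReturn T.next (dartsFrom H S')
      next_mem := fun d hd => firstReturn_mem (X := dartsFrom H S') hd
      next_edge := fun d hd hd' => by
        have he := T.next_edge d (hsub hd) (hsub hd')
        rw [firstReturn_eq_of_mem (X := dartsFrom H S') hd, he]
        change (T.next d).fst ∈ S'
        rwa [he, ρ.facePerm_fst]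
      sameCycle := fun d => by
        by_cases hd : d ∈ dartsFrom H S'
        · rw [firstReturn_of_mem hd]; exact T.sameCycle_iterate _ _
        · rw [firstReturn_of_notMem hd]
      forbidden := fun a b => newForbidden (E.symm a) (E.symm b)
      forbidden_symm := fun a b h => newForbidden_symm _ _ h
      not_sameCycle := fun a b h => by simpa using hforb _ _ h }
  have hT' : ∀ a b : NewArc S' T hH hS, T'.forbidden (E a) (E b) ↔ newForbidden a b := by
    intro a b
    change newForbidden (E.symm (E a)) (E.symm (E b)) ↔ _
    rw [E.symm_apply_apply, E.symm_apply_apply]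
  refine ⟨T', ⟨?_⟩⟩
  exact
    { paths := {P | ∃ x, IsReductionPath S' P x}
      cycles := {C | ∃ x, IsReductionCycle S' C x}
      subset_verts := Set.sdiff_subset
      isCorrectPath := fun P ⟨x, hP⟩ => hP.isCorrectPath hρ
      isCorrectCycle := fun C ⟨x, hC⟩ => hC.isCorrectCycle hρ
      partition := exists_unique_list hsub
      verts_eq := (Set.sdiff_sdiff_cancel_left hsub).symm
      edges_eq := by
        ext e
        constructor
        · rintro ⟨he, h⟩
          exact ⟨⟨he, fun x hx => hsub (h x hx)⟩, fun x hx hx' => hx'.2 (h x hx)⟩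
        · rintro ⟨⟨he, h⟩, h'⟩
          exact ⟨he, fun x hx => by_contra fun hx' => h' x hx ⟨h x hx, hx'⟩⟩
      arcEquiv := E
      tail_old := fun a => congrArg (fun d : H.Dart => d.fst) (hinl a)
      head_old := fun a => by
        have hm := (E (.inl a)).2.1
        have hn : T.next a.1.1 ∈ dartsFrom H S' :=
          by_contra fun h => a.2.2 ⟨T.next_mem _ a.1.2.1, h⟩
        change (firstReturn T.next (dartsFrom H S') (E (.inl a)).1).fst = (T.next a.1.1).fst
        rw [hinl] at hm ⊢
        rw [firstReturn_eq_of_mem (X := dartsFrom H S') hm hn]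
      tail_new := fun P => ((hinr P).isSegment.head?_tail).symm
      head_new := fun P => by
        rw [(hinr P).isSegment.getLast?_head, ← firstReturn_of_mem (hinr P).fst_mem]
        rfl
      forbidden_old_old := fun a b => hT' _ _
      forbidden_new_old := fun P b => hT' _ _
      forbidden_new_new := fun P Q => hT' _ _ }

end FaceData

end Reductions

/-! ### Arcs inside 3-ears, and superbness. -/

section Superb

open SimpleGraph Equiv.Perm MixedGraph

variable {V : Type u} {H : SimpleGraph V}

theorem exists_descending_sequence {α : Type*} (good : ℕ → α → Prop) (step : ℕ → α → α → Prop)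
    (n : ℕ) (a : α) (ha : good n a)
    (hstep : ∀ i < n, ∀ a, good (i + 1) a → ∃ b, good i b ∧ step i a b) :
    ∃ M : ℕ → α, M n = a ∧ (∀ i ≤ n, good i (M i)) ∧ ∀ i < n, step i (M (i + 1)) (M i) := by
  induction n generalizing a with
  | zero =>
    refine ⟨fun _ => a, rfl, fun i hi => ?_, fun i hi => absurd hi (Nat.not_lt_zero i)⟩
    rwa [Nat.le_zero.1 hi]
  | succ n ih =>
    obtain ⟨b, hb, hab⟩ := hstep n (Nat.lt_succ_self n) a ha
    obtain ⟨M, hM, hgood, hs⟩ := ih b hb fun i hi => hstep i (by omega)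
    refine ⟨Function.update M (n + 1) a, by simp, fun i hi => ?_, fun i hi => ?_⟩
    · rcases hi.lt_or_eq with h | rfl
      · rw [Function.update_of_ne (by omega)]; exact hgood i (by omega)
      · simpa using ha
    · rcases (Nat.lt_succ_iff.1 hi).lt_or_eq with h | rfl
      · rw [Function.update_of_ne (by omega), Function.update_of_ne (by omega)]
        exact hs i h
      · rw [Function.update_self, Function.update_of_ne (by omega), hM]
        exact hab

namespace EarDecomposition

/-- Each part of an ear decomposition is an induced subgraph. -/
theorem part_adj (D : EarDecomposition H) {i : ℕ} (hi : i ≤ D.n) {u v : V} (h : H.Adj u v)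
    (hu : u ∈ (D.part i).verts) (hv : v ∈ (D.part i).verts) : (D.part i).Adj u v := by
  induction hi using Nat.decreasingInduction with
  | self => rw [D.part_last]; exact h
  | of_succ i hi ih =>
    have := ih (by rw [D.part_verts_succ hi]; exact .inl hu)
      (by rw [D.part_verts_succ hi]; exact .inl hv)
    rw [D.part_succ i hi, Subgraph.sup_adj] at this
    rcases this with h | h
    · exact h
    · obtain ⟨a, b, p, -, hp, -, -, hint⟩ := (D.isEar hi).exists_path h
      obtain ⟨x, hx, hx'⟩ := hint _ hp
      rw [D.internalVerts_eq hi] at hx'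
      rcases Sym2.mem_iff.1 hx with rfl | rfl
      · exact absurd hu hx'.2
      · exact absurd hv hx'.2

theorem ear_adj (D : EarDecomposition H) {i : ℕ} (hi : i < D.n) {u v : V} (h : H.Adj u v)
    (hu : u ∈ internalVerts (D.ear (i + 1))) (hv : v ∈ (D.part (i + 1)).verts) :
    (D.ear (i + 1)).Adj u v := by
  rw [D.internalVerts_eq hi] at hu
  have := D.part_adj (i := i + 1) hi h hu.1 hv
  rw [D.part_succ i hi, Subgraph.sup_adj] at this
  rcases this with h | h
  · exact absurd h.fst_mem hu.2
  · exact h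

/-- A cycle is 2-regular, so a cubic graph needs an ear; this makes the choice `j = 1` admissible.
-/
theorem n_pos [H.LocallyFinite] (hH : H.IsRegularOfDegree 3) (D : EarDecomposition H) :
    0 < D.n := by
  by_contra h0
  obtain ⟨a, p, hp, h⟩ := D.part_zero
  have hlast := D.part_last
  rw [Nat.eq_zero_of_not_pos h0] at hlast
  have h2 := hp.ncard_neighborSet_toSubgraph_eq_two p.start_mem_support
  rw [← h, hlast] at h2
  have : (⊤ : H.Subgraph).neighborSet a = (H.neighborFinset a : Set V) := by
    ext w; simp
  rw [this, Set.ncard_coe_finset, card_neighborFinset_eq_degree, hH a] at h2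
  omega

/-- Parts are induced, so within the part an internal vertex sees only its two ear neighbours; its
third neighbour lies beyond. -/
theorem exists_adj_notMem [H.LocallyFinite] (hH : H.IsRegularOfDegree 3) (D : EarDecomposition H)
    {i : ℕ} (hi : i < D.n) {v : V} (hv : v ∈ internalVerts (D.ear (i + 1)))
    (h2 : ((D.ear (i + 1)).neighborSet v).ncard = 2) :
    ∃ w, H.Adj v w ∧ w ∉ (D.part (i + 1)).verts := by
  by_contra! hall
  have hsub : (H.neighborFinset v : Set V) ⊆ (D.ear (i + 1)).neighborSet v := by
    intro w hw
    rw [Finset.mem_coe, mem_neighborFinset] at hw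
    exact D.ear_adj hi hw hv (hall w hw)
  have := Set.ncard_le_ncard hsub (Set.finite_of_ncard_ne_zero (by omega))
  rw [Set.ncard_coe_finset, card_neighborFinset_eq_degree, hH v] at this
  omega

theorem exists_walk_internalVerts {L : H.Subgraph} (hL : IsKEar 3 L) {x y : V}
    (hx : x ∈ internalVerts L) (hy : y ∈ internalVerts L) :
    ∃ p : H.Walk x y, ∀ w ∈ p.support, w ∈ internalVerts L := by
  obtain ⟨a, v₁, v₂, v₃, b, -, -, h12, h23, -, hI, -⟩ := hL.exists_verts
  have key : ∀ x ∈ internalVerts L, ∃ p : H.Walk x v₂, ∀ w ∈ p.support, w ∈ internalVerts L := by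
    rw [hI]
    rintro x (rfl | rfl | rfl)
    · exact ⟨.cons h12.adj_sub .nil, by simp⟩
    · exact ⟨.nil, by simp⟩
    · exact ⟨.cons h23.adj_sub.symm .nil, by simp⟩
  obtain ⟨p, hp⟩ := key x hx
  obtain ⟨q, hq⟩ := key y hy
  refine ⟨p.append q.reverse, fun w hw => ?_⟩
  rw [Walk.mem_support_append_iff, Walk.support_reverse, List.mem_reverse] at hw
  exact hw.elim (hp w) (hq w)

/-- If the descendant of a 3-ear has at most two components, then some closed walk that leaves the
ear exactly once in a given direction avoids the preceding part. -/
theorem exists_closed_walk_of_descendant [Finite V] [DecidableEq V] [H.LocallyFinite]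
    (hH : H.IsRegularOfDegree 3) (D : EarDecomposition H) {i : ℕ} (hi : i < D.n)
    (hk : IsKEar 3 (D.ear (i + 1))) (hdesc : (D.descendantComponents (i + 1)).ncard ≤ 2) :
    ∃ v ∈ internalVerts (D.ear (i + 1)), ∃ x ∉ (D.part (i + 1)).verts, H.Adj v x ∧
      ∃ p : H.Walk v v, p.edges.count s(v, x) = 1 ∧ ∀ w ∈ p.support, w ∉ (D.part i).verts := by
  obtain ⟨a, v₁, v₂, v₃, b, -, -, -, -, -, hI, h2⟩ := hk.exists_verts
  have hcomp : ∀ v ∈ internalVerts (D.ear (i + 1)), ∃ C ∈ D.descendantComponents (i + 1),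
      ∃ x ∈ C.supp, H.Adj v x := by
    intro v hv
    obtain ⟨w, hw, hw'⟩ := D.exists_adj_notMem hH hi hv (h2 v hv)
    exact ⟨connectedComponentMk _ ⟨w, hw'⟩, ⟨⟨w, hw'⟩, rfl, v, hv, hw⟩, ⟨w, hw'⟩, rfl, hw⟩
  have hne : Nonempty (H.induce ((D.part (i + 1)).verts)ᶜ).ConnectedComponent :=
    ⟨(hcomp v₁ (by simp [hI])).choose⟩
  choose! C hC hCx using hcomp
  -- Three internal vertices and at most two components: two of the vertices share one.
  obtain ⟨v, hv, v', hv', hvv, hCC⟩ := Set.exists_ne_map_eq_of_ncard_lt_of_maps_to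
    (by rw [hk.2.2]; omega) hC (Set.toFinite _)
  obtain ⟨x, hx, hvx⟩ := hCx v hv
  obtain ⟨x', hx', hvx'⟩ := hCx v' hv'
  rw [ConnectedComponent.mem_supp_iff] at hx hx'
  obtain ⟨q⟩ := ConnectedComponent.exact (hx.trans (hCC.trans hx'.symm))
  let q' : H.Walk x x' := q.map (Embedding.induce _).toHom
  have hq' : ∀ w ∈ q'.support, w ∉ (D.part (i + 1)).verts := by
    intro w hw
    replace hw : w ∈ (q.map (Embedding.induce _).toHom).support := hw
    rw [Walk.support_map, List.mem_map] at hw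
    obtain ⟨y, -, rfl⟩ := hw
    exact y.2
  obtain ⟨r, hr⟩ := exists_walk_internalVerts hk hv' hv
  have hIU := D.internalVerts_eq hi
  have hle : (D.part i).verts ⊆ (D.part (i + 1)).verts := by
    rw [D.part_verts_succ hi]; exact Set.subset_union_left
  have hvS : v ∈ (D.part (i + 1)).verts := by rw [hIU] at hv; exact hv.1
  -- Leave the ear from `v` to `x`, cross the component to `x'`, re-enter the ear at `v'` and return
  -- to `v` inside it.
  refine ⟨v, hv, x, x.2, hvx, .cons hvx (q'.append (.cons hvx'.symm r)), ?_, ?_⟩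
  · rw [Walk.edges_cons, List.count_cons_self, List.count_eq_zero_of_not_mem]
    rw [Walk.edges_append, Walk.edges_cons, List.mem_append, List.mem_cons]
    rintro (h | h | h)
    · exact hq' v (q'.fst_mem_support_of_mem_edges h) hvS
    · rcases Sym2.eq_iff.1 h with ⟨h, -⟩ | ⟨h, -⟩
      · exact x'.2 (h ▸ hvS)
      · exact hvv h
    · have := hr x (r.snd_mem_support_of_mem_edges h)
      rw [hIU] at this
      exact x.2 this.1
  · intro w hw hwS
    rw [Walk.support_cons, List.mem_cons, Walk.mem_support_append_iff, Walk.support_cons,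
      List.mem_cons] at hw
    rw [hIU] at hv
    rcases hw with rfl | h | rfl | h
    · exact hv.2 hwS
    · exact hq' w h (hle hwS)
    · exact x'.2 (hle hwS)
    · have := hr w h
      rw [hIU] at this
      exact this.2 hwS

end EarDecomposition

namespace FaceData

variable {ρ : RotationSystem H}

/-- The mixed graph of segments of facial walks has an arc with both ends in the 3-ear. -/
theorem exists_arc_within [Finite V] [H.LocallyFinite] (hH : H.IsRegularOfDegree 3)
    (D : EarDecomposition H) (hiso : ∀ v, ∃ w, H.Adj v w)
    (heuler : Nat.card V + ρ.numFaces = H.edgeSet.ncard + 2 * Nat.card H.ConnectedComponent)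
    {i : ℕ} (hi : i < D.n) (hk : IsKEar 3 (D.ear (i + 1)))
    (hdesc : (D.descendantComponents (i + 1)).ncard ≤ 2)
    (T : FaceData ρ (D.part (i + 1)).verts) :
    ∃ a : OutDart H (D.part (i + 1)).verts, a.1.fst ∈ internalVerts (D.ear (i + 1)) ∧
      (T.next a.1).fst ∈ internalVerts (D.ear (i + 1)) := by
  classical
  obtain ⟨v, hv, x, hx, hvx, p, hcount, hp⟩ :=
    D.exists_closed_walk_of_descendant hH hi hk hdesc
  obtain ⟨φ, hface, hφ⟩ := exists_face_coloring D.connected ρ hiso heuler p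
  have hIU := D.internalVerts_eq hi
  -- The walk avoids the preceding part, so no colour change happens across edges meeting it.
  have hsymm : ∀ d : H.Dart, d.fst ∈ (D.part i).verts → φ d.symm = φ d := by
    intro d hd
    have hnot : d.edge ∉ p.edges := fun h =>
      hp d.fst (p.mem_support_of_mem_edges h (Sym2.mem_mk_left _ _)) hd
    have := hφ d
    rw [List.count_eq_zero_of_not_mem hnot, Nat.cast_zero] at this
    exact (CharTwo.add_eq_zero.1 this).symm
  have hnext : ∀ d : H.Dart, d.fst ∈ (D.part i).verts → φ (ρ.next d) = φ d := fun d hd =>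
    (hface _ _ (ρ.sameCycle_next d)).symm.trans (hsymm d hd)
  obtain ⟨u, hu⟩ := (D.connected_part hi.le).nonempty
  obtain ⟨u', hu'⟩ := hiso u
  let e : H.Dart := ⟨(u, u'), hu'⟩
  have hconst : ∀ d : H.Dart, d.fst ∈ (D.part i).verts → φ d = φ e := by
    intro d hd
    obtain ⟨q, hq⟩ := (D.connected_part hi.le).exists_walk hd hu
    exact ρ.eq_of_walk φ q (fun d hd => hnext d (hq _ hd)) (fun d hd => hsymm d (hq _ hd)) d e
      rfl rfl
  have hmem : ∀ d : H.Dart, d.fst ∈ (D.part (i + 1)).verts → φ d ≠ φ e →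
      d.fst ∈ internalVerts (D.ear (i + 1)) := by
    intro d hd hne
    rw [hIU]
    exact ⟨hd, fun h => hne (hconst d h)⟩
  have hvS : v ∈ (D.part (i + 1)).verts := by rw [hIU] at hv; exact hv.1
  let d₀ : H.Dart := ⟨(v, x), hvx⟩
  have hd₀ : φ d₀ ≠ φ d₀.symm := by
    intro h
    have h1 := hφ d₀
    rw [← h, CharTwo.add_self_eq_zero, show d₀.edge = s(v, x) from rfl, hcount] at h1
    exact zero_ne_one (h1.trans Nat.cast_one)
  -- One side of `d₀` has a colour other than that of the preceding part. If it is the side of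
  -- `d₀.symm`, the arc sought enters `v` through `d₀.symm`; otherwise it leaves `v` through `d₀`.
  by_cases hcol : φ d₀ = φ e
  · obtain ⟨w, hw⟩ := T.next.surjective (ρ.facePerm d₀.symm)
    have hfst : (ρ.facePerm d₀.symm).fst = v := ρ.facePerm_fst _
    have hwS : w.fst ∈ (D.part (i + 1)).verts := by
      have := T.next_symm_mem (d := ρ.facePerm d₀.symm) (hfst ▸ hvS)
      rwa [← hw, Equiv.symm_apply_apply] at this
    have hwφ : φ w = φ d₀.symm := by
      rw [hface _ _ (T.sameCycle w), hw]
      exact (hface _ _ ⟨1, by simp⟩).symm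
    refine ⟨⟨w, hwS, fun hsnd => ?_⟩, hmem w hwS (fun h => hd₀ (hcol.trans (hwφ ▸ h).symm)), ?_⟩
    · rw [T.next_edge w hwS hsnd] at hw
      rw [ρ.facePerm.injective hw] at hwS
      exact hx hwS
    · rw [hw, hfst]; exact hv
  · refine ⟨⟨d₀, hvS, hx⟩, hv, hmem _ (T.next_mem _ hvS) ?_⟩
    rwa [← hface _ _ (T.sameCycle d₀)]

theorem not_isCutObstacle [Finite V] [H.LocallyFinite] (hH : H.IsRegularOfDegree 3)
    (D : EarDecomposition H) (hiso : ∀ v, ∃ w, H.Adj v w)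
    (heuler : Nat.card V + ρ.numFaces = H.edgeSet.ncard + 2 * Nat.card H.ConnectedComponent)
    {i : ℕ} (hi : i < D.n) (hk : IsKEar 3 (D.ear (i + 1)))
    (hdesc : (D.descendantComponents (i + 1)).ncard ≤ 2)
    (hS : HasMinDegreeTwo H (D.part (i + 1)).verts) (T : FaceData ρ (D.part (i + 1)).verts) :
    ¬ (T.toMixedGraph hH hS).IsCutObstacle (internalVerts (D.ear (i + 1))) := by
  obtain ⟨c, hc, hc'⟩ := T.exists_arc_within hH D hiso heuler hi hk hdesc
  obtain ⟨a, v₁, v₂, v₃, b, hn, ha, -, -, hb, hI, -⟩ := hk.exists_verts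
  set M := T.toMixedGraph hH hS with hM
  set U := internalVerts (D.ear (i + 1)) with hU
  have : Finite M.Arc := M.finite_arc
  have hUS : U ⊆ M.verts := by
    rw [hU, D.internalVerts_eq hi]; exact Set.sdiff_subset
  -- Two of the three neighbours of `v` lie in the part, so at most one dart leaves it.
  have htail : ∀ v ∈ M.verts, {e | M.tail e = v}.ncard ≤ 1 := by
    intro v hv
    rw [Set.ncard_le_one]
    intro d hd e he
    by_contra hne
    obtain ⟨s, hs, t, ht, hst⟩ := (Set.one_lt_ncard (Set.toFinite _)).1 (hS v hv)
    have hd' : d.1.fst = v := hd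
    have he' : e.1.fst = v := he
    refine hH.not_four hs.1 ht.1 (hd' ▸ d.1.adj) (he' ▸ e.1.adj) ?_
    have h1 := d.2.2
    have h2 := e.2.2
    have h3 := hs.2
    have h4 := ht.2
    have hde : d.1.snd ≠ e.1.snd := fun h =>
      hne (Subtype.ext (Dart.ext _ _ (Prod.ext (hd'.trans he'.symm) h)))
    simp only [List.nodup_cons, List.mem_cons, List.not_mem_nil, or_false, not_or,
      not_false_eq_true, List.nodup_nil, and_true]
    refine ⟨⟨hst, ?_, ?_⟩, ⟨?_, ?_⟩, hde⟩ <;> rintro rfl <;> contradiction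
  have hhead : ∀ v ∈ M.verts, {e | M.head e = v}.ncard ≤ 1 := by
    intro v hv
    have h1 := M.degree_add_out v hv
    have h2 := M.degree_add_in v hv
    have h3 := htail v hv
    omega
  have hcount : ∀ (c : M.Arc) (f : M.Arc → V), (∀ v ∈ M.verts, {e | f e = v}.ncard ≤ 1) → f c ∈ U →
      ({e | f e ∈ U} \ {c}).ncard ≤ 2 := by
    intro c f hf hfc
    have h3 : {e | f e ∈ U}.ncard ≤ 3 := by
      rw [← hk.2.2]
      refine Set.ncard_le_ncard_of_injOn f (fun e he => he) ?_ (Set.finite_of_ncard_ne_zero ?_)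
      · intro d hd e he hde
        exact (Set.ncard_le_one (Set.toFinite _)).1 (hf (f e) (hUS he)) d hde e rfl
      · rw [hk.2.2]; omega
    rw [Set.ncard_sdiff_singleton_of_mem (s := {e | f e ∈ U}) hfc]
    omega
  -- Of at most three arcs with tail in `U` and at most three with head in `U`, the inner arc `c` is
  -- one of each kind, leaving at most `2 + 2` across the boundary.
  have harcs : {e : M.Arc | (M.tail e ∈ U ∧ M.head e ∉ U) ∨
      (M.tail e ∉ U ∧ M.head e ∈ U)}.ncard ≤ 4 := by
    have hsub : {e : M.Arc | (M.tail e ∈ U ∧ M.head e ∉ U) ∨ (M.tail e ∉ U ∧ M.head e ∈ U)} ⊆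
        ({e | M.tail e ∈ U} \ {(c : M.Arc)}) ∪ ({e | M.head e ∈ U} \ {(c : M.Arc)}) := by
      rintro e (⟨h1, h2⟩ | ⟨h1, h2⟩)
      · exact .inl ⟨h1, fun h => h2 (by rw [Set.mem_singleton_iff.1 h]; exact hc')⟩
      · exact .inr ⟨h2, fun h => h1 (by rw [Set.mem_singleton_iff.1 h]; exact hc)⟩
    have h1 := Set.ncard_le_ncard hsub (Set.toFinite _)
    have h2 := Set.ncard_union_le ({e | M.tail e ∈ U} \ {(c : M.Arc)}) ({e | M.head e ∈ U} \ {(c : M.Arc)})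
    have h3 := hcount c M.tail htail hc
    have h4 := hcount c M.head hhead hc'
    omega
  have hedges : 2 ≤ {e ∈ M.edges | (∃ v ∈ e, v ∈ U) ∧ ∃ v ∈ e, v ∉ U}.ncard := by
    have hear : (D.ear (i + 1)).verts ⊆ (D.part (i + 1)).verts := by
      rw [D.part_verts_succ hi]; exact Set.subset_union_right
    simp only [List.nodup_cons, List.mem_cons, List.not_mem_nil, or_false, not_or] at hn
    have hmem : ∀ s t, (D.ear (i + 1)).Adj s t → s ∉ U → t ∈ U →
        s(s, t) ∈ {e ∈ M.edges | (∃ v ∈ e, v ∈ U) ∧ ∃ v ∈ e, v ∉ U} := by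
      intro s t hst hs ht
      refine ⟨⟨hst.adj_sub, fun y hy => ?_⟩, ⟨t, by simp, ht⟩, ⟨s, by simp, hs⟩⟩
      rcases Sym2.mem_iff.1 hy with rfl | rfl
      · exact hear hst.fst_mem
      · exact hear hst.snd_mem
    have h1 := hmem a v₁ ha (by rw [hI]; simp; tauto) (by rw [hI]; simp)
    have h2 := hmem b v₃ hb.symm (by rw [hI]; simp; tauto) (by rw [hI]; simp)
    have hne : s(a, v₁) ≠ s(b, v₃) := by
      rw [Ne, Sym2.eq_iff]; tauto
    rw [← Set.ncard_pair hne]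
    refine Set.ncard_le_ncard ?_ (Set.toFinite _)
    rintro e (rfl | rfl)
    · exact h1
    · exact h2
  rw [MixedGraph.IsCutObstacle]
  omega

end FaceData

end Superb

theorem mainTheorem8 {V : Type u} [Fintype V] (H : SimpleGraph V) [H.LocallyFinite]
    (hH : IsTrigraph H) (hplanar : IsPlanarGraph H)
    (D : EarDecomposition H) (hD : D.IsRobust) :
    D.IsSuperb := by
  obtain ⟨ρ, heuler⟩ := hplanar
  have hreg := hH.1
  have hiso : ∀ v, ∃ w, H.Adj v w := fun v => by
    have h : 0 < H.degree v := by rw [hreg v]; omega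
    exact (H.degree_pos_iff_exists_adj v).1 h
  have hρ := D.not_sameCycle_symm ρ hiso heuler
  have hdeg : ∀ i ≤ D.n, HasMinDegreeTwo H (D.part i).verts :=
    fun i hi v hv => D.two_le_ncard_neighbors hi hv
  let good : ℕ → MixedGraph V → Prop := fun i M =>
    ∃ (hi : i ≤ D.n) (T : FaceData ρ (D.part i).verts), M = T.toMixedGraph hreg (hdeg i hi)
  have huniv : (D.part D.n).verts = Set.univ := by rw [D.part_last]; rfl
  have hall : ∀ v, v ∈ (D.part D.n).verts := fun v => huniv ▸ Set.mem_univ v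
  -- The last part contains all vertices, so no dart leaves it: there are no arcs and hence no
  -- forbidden pairs.
  let T₀ : FaceData ρ (D.part D.n).verts :=
    { next := ρ.facePerm
      next_mem := fun d _ => hall _
      next_edge := fun d _ _ => rfl
      sameCycle := fun d => ⟨1, by simp⟩
      forbidden := fun _ _ => False
      forbidden_symm := fun _ _ h => h
      not_sameCycle := fun _ _ h => h.elim }
  obtain ⟨M, hMn, hgood, hstep⟩ := exists_descending_sequence good
    (fun i M M' => Nonempty (MixedGraph.CorrectReduction M (internalVerts (D.ear (i + 1))) M')) D.n
    (T₀.toMixedGraph hreg (hdeg _ le_rfl)) ⟨le_rfl, T₀, rfl⟩ (by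
      rintro i hi _ ⟨hi', T, rfl⟩
      have hsub : (D.part i).verts ⊆ (D.part (i + 1)).verts := by
        rw [D.part_verts_succ hi]; exact Set.subset_union_left
      obtain ⟨T', hT'⟩ := T.exists_correctReduction (hH := hreg) (hS := hdeg _ hi') hsub
        (hdeg i hi.le) hρ
      refine ⟨_, ⟨hi.le, T', rfl⟩, ?_⟩
      rwa [D.internalVerts_eq hi])
  -- Every reduction along the faces succeeds, so the sequence runs down to `j = 1`.
  refine ⟨1, le_rfl, D.n_pos hreg, M, ⟨?_, fun i _ hi => hstep i hi⟩, .inl rfl, ?_⟩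
  · rw [hMn]
    refine ⟨huniv, ?_, ⟨fun a => a.2.2 (hall _)⟩⟩
    ext e
    exact ⟨fun h => h.1, fun h => ⟨h, fun _ _ => hall _⟩⟩
  · intro i h1 _ hi hk
    obtain ⟨i, rfl⟩ := Nat.exists_eq_add_one.2 h1
    obtain ⟨hi', T, hT⟩ := hgood _ hi
    rw [hT]
    exact T.not_isCutObstacle hreg D hiso heuler hi hk (hD _ h1 hi hk).1 (hdeg _ hi')
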